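/- A rooted Bernoulli percolation on $\mathbb N$ (with parameter $\tfrac12$) is a random set $A\subseteq\{0,1,2,\dots\}$ which contains $0$ deterministically and contains each integer $k\ge 1$ with probability $\tfrac12$, independently for different $k$. For $S\subseteq\{0,1,2,\dots\}$ let $S(n)$ be the set of the first (smallest) $n$ points of $S$, with the metric $|x-y|$. For metric spaces $X,Y$ with base points $a,b$, a map $T:X\to Y$ is a rooted rough isometry with constants $(M,D,R)$ if $T(a)=b$, $\frac1M d(x_1,x_2)-D\le d(T(x_1),T(x_2))\le M d(x_1,x_2)+D$ for all $x_1,x_2\in X$, and every $y\in Y$ is within distance $R$ of some $T(x)$. For $S,U\subseteq\{0,1,2,\dots\}$ both containing $0$, a map $T:S\to U$ is a Markov rough isometry with constants $(M,F,R)$ if (i) $T(0)=0$; (ii) $T$ is weakly increasing; (iii) $\frac1M|x-y|\le|T(x)-T(y)|\le M|x-y|$ for all adjacent $x,y\in S$ (no point of $S$ strictly between them) with $T(x)\ne T(y)$; (iv) $\max T^{-1}(b)-\min T^{-1}(b)\le F$ for every $b\in T(S)$; (v) for every $b\in U$ there is $x\in S$ with $|T(x)-b|\le R$. **Theorem 2.5.**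 There exists $N>0$ such that, given two independent rooted Bernoulli percolations $A$ and $B$ on $\mathbb N$, for every $n>N$ there is a random $m$ (a measurable function of $A$ and $B$, depending on $n$) such that with probability at least $1-2^{-8\sqrt{\log_2 n}}$ there is a map $T:A(n)\to B(m)$ which is a rooted rough isometry from $(A(n),0)$ to $(B(m),0)$ with constants $\left(30\sqrt{\log_2 n},\tfrac12,10\sqrt{\log_2 n}\right)$. Moreover $T$ can be taken to be weakly increasing and, in fact, a Markov rough isometry with constants $\left(10\sqrt{\log_2 n},10\sqrt{\log_2 n},10\sqrt{\log_2 n}\right)$. -/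

import Mathlib

open MeasureTheory ProbabilityTheory

/-- `A` is a rooted Bernoulli percolation on the natural numbers with parameter `1/2`: a random
subset `A` of `{0, 1, 2, …}` that contains `0` deterministically and contains each `k ≥ 1` with
probability `1/2`, independently for different `k`. -/
structure IsRootedBernoulliPercolation {Ω : Type*} [MeasurableSpace Ω] (A : Ω → Set ℕ)
    (μ : Measure Ω) : Prop where
  measurable : Measurable A
  zero_mem : ∀ ω, 0 ∈ A ω
  prob_mem : ∀ k : ℕ, 1 ≤ k → μ {ω | k ∈ A ω} = 1 / 2
  indep : iIndepSet (fun k : ℕ => {ω | k + 1 ∈ A ω}) μ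

/-- The set of the first `n` points (in increasing order) of a set `S` of natural numbers: those
points of `S` that have fewer than `n` points of `S` strictly below them. -/
def firstPoints (S : Set ℕ) (n : ℕ) : Set ℕ :=
  {a | a ∈ S ∧ (S ∩ Set.Iio a).ncard < n}

/-- `T : X → Y` is a rough isometry with constants `(M, D, R)`. -/
structure IsRoughIsometry {X Y : Type*} [MetricSpace X] [MetricSpace Y] (T : X → Y)
    (M D R : ℝ) : Prop where
  M_pos : 0 < M
  D_nonneg : 0 ≤ D
  R_nonneg : 0 ≤ R
  lower : ∀ x₁ x₂ : X, 1 / M * dist x₁ x₂ - D ≤ dist (T x₁) (T x₂)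
  upper : ∀ x₁ x₂ : X, dist (T x₁) (T x₂) ≤ M * dist x₁ x₂ + D
  dense : ∀ y : Y, ∃ x : X, dist y (T x) ≤ R

/-- `T` is a rooted rough isometry from `(X, a)` to `(Y, b)` with constants `(M, D, R)`. -/
structure IsRootedRoughIsometry {X Y : Type*} [MetricSpace X] [MetricSpace Y] (a : X) (b : Y)
    (T : X → Y) (M D R : ℝ) : Prop extends IsRoughIsometry T M D R where
  map_root : T a = b

/-- `T : S → U` is a Markov rough isometry with constants `(M, F, R)` between two sets of natural
numbers containing `0` (each with the metric `|x - y|`). In `adjacent`, `x ⋖ y` says that `x < y`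
are points of `S` with no point of `S` strictly between them. -/
structure IsMarkovRoughIsometry {S U : Set ℕ} (hS : 0 ∈ S) (hU : 0 ∈ U) (T : S → U)
    (M F R : ℝ) : Prop where
  M_pos : 0 < M
  F_nonneg : 0 ≤ F
  R_nonneg : 0 ≤ R
  map_zero : T ⟨0, hS⟩ = ⟨0, hU⟩
  monotone : ∀ x y : S, y ≤ x → T y ≤ T x
  adjacent : ∀ x y : S, x ⋖ y → T x ≠ T y →
    1 / M * dist x y ≤ dist (T x) (T y) ∧ dist (T x) (T y) ≤ M * dist x y
  /-- Every nonempty fibre has diameter (maximum minus minimum) at most `F`. -/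
  fibre : ∀ x y : S, T x = T y → dist x y ≤ F
  dense : ∀ b : U, ∃ x : S, dist (T x) b ≤ R

/-! Put `q = ⌊√(log₂ n) / 20⌋`, so that `n` is at most `2 ^ (20 q + 20)²` and a multiplicative
constant `M = 200 q` is allowed. Up to distance `2 ^ (410 q²)` both sets typically have gaps of
length at most `800 q²`. The map is glued from pieces (`SegMap`), and only the gaps of `B` longer
than `180 q` obstruct it.

Over a stretch of `B` without such long gaps, any reasonably dense piece of `A` of comparable length
will do (`exists_segMap_of_short`): the map is the maximum of a slow one, which advances once per
block of length `200 q` of `A`, and a fast one, which advances at every point and is anchored at the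
right end.

A long gap of length `h` must be the image of a gap of `A` of length at least `h / (200 q)`, which
is at most about `4 q` and so not rare. Long gaps closer than `2 ^ (18 q)` form a cluster, and the
whole cluster is matched with one pattern in `A`, of probability at least `2 ^ (-cost)`. A cluster
of cost above `14 q` would make so many integers absent from `B` that a union bound over all
clusters excludes it (`prob_cost_gt`). A pattern of cost at most `14 q` recurs in `A` within a time
shorter than half of `2 ^ (18 q)` (`prob_no_hit`). Before each cluster `B` offers a stretch of
length at least `2 ^ (18 q)` without long gaps. It may be matched with a piece of `A` of anything
from half to all of its length, and this freedom absorbs the waiting time (`exists_segMap_wait`).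

Iteration yields a map defined on the first `n` points of `A` (`exists_segMap_far`); union bounds
show that the sets are good with the required probability. -/

/-! ### Partial maps and their concatenation -/

/-- `p < p'` are consecutive points of `A`. -/
def AdjIn (A : Set ℕ) (p p' : ℕ) : Prop :=
  p ∈ A ∧ p' ∈ A ∧ p < p' ∧ ∀ z ∈ A, z ≤ p ∨ p' ≤ z

/-- `T` restricts to a map `A ∩ [x, y] → B ∩ [u, v]` that satisfies the conditions of a Markov rough
isometry with all three constants `M`, and `y` is the only point mapped to `v`. -/
structure SegMap (A B : Set ℕ) (M x y u v : ℕ) (T : ℕ → ℕ) : Prop where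
  left_le : x ≤ y
  left_mem : x ∈ A
  right_mem : y ∈ A
  map_left : T x = u
  map_right : T y = v
  maps : ∀ p ∈ A, x ≤ p → p ≤ y → T p ∈ B
  mono : ∀ p ∈ A, ∀ p' ∈ A, x ≤ p → p ≤ p' → p' ≤ y → T p ≤ T p'
  adj_lower : ∀ p p', AdjIn A p p' → x ≤ p → p' ≤ y → T p ≠ T p' → p' + M * T p ≤ p + M * T p'
  adj_upper : ∀ p p', AdjIn A p p' → x ≤ p → p' ≤ y → T p' + M * p ≤ T p + M * p'
  fibre : ∀ p ∈ A, ∀ p' ∈ A, x ≤ p → p ≤ p' → p' ≤ y → T p = T p' → p' ≤ p + M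
  top : ∀ p ∈ A, x ≤ p → p < y → T p < v
  dense : ∀ b ∈ B, u ≤ b → b ≤ v → ∃ p ∈ A, x ≤ p ∧ p ≤ y ∧ b ≤ T p + M ∧ T p ≤ b + M

theorem SegMap.refl {A B : Set ℕ} {x u : ℕ} (M : ℕ) (hx : x ∈ A) (hu : u ∈ B) :
    SegMap A B M x x u u (fun _ => u) where
  left_le := le_rfl
  left_mem := hx
  right_mem := hx
  map_left := rfl
  map_right := rfl
  maps := fun _ _ _ _ => hu
  mono := fun _ _ _ _ _ _ _ => le_rfl
  adj_lower := fun _ _ _ _ _ h => absurd rfl h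
  adj_upper := fun p p' h _ _ => by
    have := Nat.mul_le_mul_left M h.2.2.1.le
    omega
  fibre := fun p _ p' _ _ _ _ _ => by omega
  top := fun p _ _ _ => by omega
  dense := fun b _ _ _ => ⟨x, hx, le_rfl, le_rfl, by omega, by omega⟩

/-- Concatenation of two partial maps. -/
theorem SegMap.trans {A B : Set ℕ} {M x y z u v w : ℕ} {T T' : ℕ → ℕ}
    (h : SegMap A B M x y u v T) (h' : SegMap A B M y z v w T') :
    SegMap A B M x z u w (fun p => if p ≤ y then T p else T' p) := by
  have hyT : T y = T' y := h.map_right.trans h'.map_left.symm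
  have hle : ∀ p, p ≤ y → (if p ≤ y then T p else T' p) = T p := fun p hp => if_pos hp
  have hge : ∀ p, y ≤ p → (if p ≤ y then T p else T' p) = T' p := by
    intro p hp
    rcases hp.eq_or_lt with rfl | hp
    · simp [hyT]
    · simp [hp.not_ge]
  have hxy := h.left_le
  have hyz := h'.left_le
  have hside : ∀ p p', AdjIn A p p' → p' ≤ y ∨ y ≤ p := by
    intro p p' ha
    exact (ha.2.2.2 y h.right_mem).symm
  refine ⟨hxy.trans hyz, h.left_mem, h'.right_mem, ?_, ?_, ?_, ?_, ?_, ?_, ?_, ?_, ?_⟩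
  · exact (hle x hxy).trans h.map_left
  · exact (hge z hyz).trans h'.map_right
  · intro p hp h1 h2
    rcases le_total p y with hpy | hpy
    · simp only [hle p hpy]; exact h.maps p hp h1 hpy
    · simp only [hge p hpy]; exact h'.maps p hp hpy h2
  · intro p hp p' hp' h1 h2 h3
    rcases le_total p y with hpy | hpy
    · rcases le_total p' y with hpy' | hpy'
      · simp only [hle p hpy, hle p' hpy']; exact h.mono p hp p' hp' h1 h2 hpy'
      · simp only [hle p hpy, hge p' hpy']
        calc T p ≤ T y := h.mono p hp y h.right_mem h1 hpy le_rfl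
          _ = T' y := hyT
          _ ≤ T' p' := h'.mono y h.right_mem p' hp' le_rfl hpy' h3
    · simp only [hge p hpy, hge p' (hpy.trans h2)]
      exact h'.mono p hp p' hp' hpy h2 h3
  · intro p p' ha h1 h2
    rcases hside p p' ha with hs | hs
    · simp only [hle p (ha.2.2.1.le.trans hs), hle p' hs]
      exact h.adj_lower p p' ha h1 hs
    · simp only [hge p hs, hge p' (hs.trans ha.2.2.1.le)]
      exact h'.adj_lower p p' ha hs h2
  · intro p p' ha h1 h2
    rcases hside p p' ha with hs | hs
    · simp only [hle p (ha.2.2.1.le.trans hs), hle p' hs]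
      exact h.adj_upper p p' ha h1 hs
    · simp only [hge p hs, hge p' (hs.trans ha.2.2.1.le)]
      exact h'.adj_upper p p' ha hs h2
  · intro p hp p' hp' h1 h2 h3
    rcases le_total p y with hpy | hpy
    · rcases le_total p' y with hpy' | hpy'
      · simp only [hle p hpy, hle p' hpy']; exact h.fibre p hp p' hp' h1 h2 hpy'
      · simp only [hle p hpy, hge p' hpy']
        intro heq
        have hm := h'.mono y h.right_mem p' hp' le_rfl hpy' h3
        -- No fibre crosses the junction: by `top`, points before `y` stay strictly below `v`.
        rcases hpy.eq_or_lt with rfl | hlt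
        · exact h'.fibre p h.right_mem p' hp' le_rfl hpy' h3 (hyT ▸ heq)
        · have := h.top p hp h1 hlt
          have := h'.map_left
          omega
    · simp only [hge p hpy, hge p' (hpy.trans h2)]
      exact h'.fibre p hp p' hp' hpy h2 h3
  · intro p hp h1 h2
    rcases lt_or_ge p y with hpy | hpy
    · simp only [hle p hpy.le]
      have := h.top p hp h1 hpy
      have := h'.mono y h.right_mem z h'.right_mem le_rfl hyz le_rfl
      have := h'.map_left
      have := h'.map_right
      omega
    · simp only [hge p hpy]
      exact h'.top p hp hpy h2
  · intro b hb h1 h2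
    rcases le_total b v with hbv | hbv
    · obtain ⟨p, hp, h3, h4, h5⟩ := h.dense b hb h1 hbv
      exact ⟨p, hp, h3, h4.trans hyz, by simpa only [hle p h4] using h5⟩
    · obtain ⟨p, hp, h3, h4, h5⟩ := h'.dense b hb hbv h2
      exact ⟨p, hp, hxy.trans h3, h4, by simpa only [hge p h3] using h5⟩

/-- A single step between consecutive points. -/
theorem segMap_step {A B : Set ℕ} {M x y u v : ℕ} (hA : AdjIn A x y) (hB : AdjIn B u v)
    (h1 : y - x ≤ M * (v - u)) (h2 : v - u ≤ M * (y - x)) :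
    SegMap A B M x y u v (fun p => if p ≤ x then u else v) := by
  obtain ⟨hx, hy, hxy, hA'⟩ := hA
  obtain ⟨hu, hv, huv, hB'⟩ := hB
  have hends : ∀ p ∈ A, x ≤ p → p ≤ y → p = x ∨ p = y := by
    intro p hp h3 h4
    rcases hA' p hp with h | h <;> omega
  have hy' : ¬ y ≤ x := by omega
  have hadj : ∀ p p', AdjIn A p p' → x ≤ p → p' ≤ y → p = x ∧ p' = y := by
    intro p p' ha h3 h4
    have := ha.2.2.1
    rcases hends p ha.1 h3 (by omega) with rfl | rfl <;>
      rcases hends p' ha.2.1 (by omega) h4 with rfl | rfl <;> omega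
  have e1 : M * v = M * (v - u) + M * u := by rw [← Nat.mul_add]; congr 1; omega
  have e2 : M * y = M * (y - x) + M * x := by rw [← Nat.mul_add]; congr 1; omega
  refine ⟨hxy.le, hx, hy, by simp, by simp [hy'], ?_, ?_, ?_, ?_, ?_, ?_, ?_⟩
  · intro p _ _ _; split_ifs <;> assumption
  · intro p _ p' _ _ _ _; split_ifs <;> omega
  · intro p p' ha h3 h4 _
    obtain ⟨rfl, rfl⟩ := hadj p p' ha h3 h4
    simp only [le_refl, if_true, hy', if_false]; omega
  · intro p p' ha h3 h4
    obtain ⟨rfl, rfl⟩ := hadj p p' ha h3 h4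
    simp only [le_refl, if_true, hy', if_false]; omega
  · intro p hp p' hp' h3 h4 h5 heq
    rcases hends p hp h3 (by omega) with rfl | rfl
    · rcases hends p' hp' (by omega) h5 with rfl | rfl
      · omega
      · simp only [le_refl, if_true, hy', if_false] at heq; omega
    · omega
  · intro p hp h3 h4
    rcases hends p hp h3 (by omega) with rfl | rfl
    · simpa using huv
    · omega
  · intro b hb h3 h4
    rcases hB' b hb with h | h
    · exact ⟨x, hx, le_rfl, hxy.le, by simp; omega, by simp; omega⟩
    · exact ⟨y, hy, hxy.le, le_rfl, by simp [hy']; omega, by simp [hy']; omega⟩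

/-! ### Stretches without long gaps: the slow and the fast map -/

open Classical in
/-- The number of points of `A` in the finite set `s`. -/
noncomputable def countIn (A : Set ℕ) (s : Finset ℕ) : ℕ := (s.filter (· ∈ A)).card

theorem exists_greatest_mem {B : Set ℕ} {u t : ℕ} (hu : u ∈ B) (hut : u ≤ t) :
    ∃ b ∈ B, u ≤ b ∧ b ≤ t ∧ ∀ z ∈ B, z ≤ t → z ≤ b := by
  classical
  have hne : ((Finset.Icc u t).filter (· ∈ B)).Nonempty := ⟨u, by simp [hu, hut]⟩
  refine ⟨Finset.max' _ hne, ?_, ?_, ?_, ?_⟩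
  · exact (Finset.mem_filter.1 (Finset.max'_mem _ hne)).2
  · exact (Finset.mem_Icc.1 (Finset.mem_filter.1 (Finset.max'_mem _ hne)).1).1
  · exact (Finset.mem_Icc.1 (Finset.mem_filter.1 (Finset.max'_mem _ hne)).1).2
  · intro z hz hzt
    rcases le_total u z with h | h
    · exact Finset.le_max' _ _ (by simp [hz, hzt, h])
    · exact h.trans (Finset.mem_Icc.1 (Finset.mem_filter.1 (Finset.max'_mem _ hne)).1).1

theorem exists_next {A : Set ℕ} {p y : ℕ} (hp : p ∈ A) (hy : y ∈ A) (hpy : p < y) :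
    ∃ p', AdjIn A p p' ∧ p' ≤ y := by
  classical
  have hex : ∃ z, z ∈ A ∧ p < z := ⟨y, hy, hpy⟩
  refine ⟨Nat.find hex, ⟨hp, (Nat.find_spec hex).1, (Nat.find_spec hex).2, ?_⟩,
    Nat.find_min' hex ⟨hy, hpy⟩⟩
  intro z hz
  rcases le_or_gt z p with h | h
  · exact Or.inl h
  · exact Or.inr (Nat.find_min' hex ⟨hz, h⟩)

/-- A map on `A ∩ [x, y]` whose steps are at most `M` has `M`-dense image. -/
theorem dense_of_steps {A B : Set ℕ} {M x y u v : ℕ} {T : ℕ → ℕ} (hx : x ∈ A) (hy : y ∈ A)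
    (hTx : T x = u) (hTy : T y = v) (hxy : x ≤ y)
    (hstep : ∀ p p', AdjIn A p p' → x ≤ p → p' ≤ y → T p' ≤ T p + M) :
    ∀ b ∈ B, u ≤ b → b ≤ v → ∃ p ∈ A, x ≤ p ∧ p ≤ y ∧ b ≤ T p + M ∧ T p ≤ b + M := by
  intro b _ h1 h2
  -- The last point whose image does not exceed `b`; the next image passes `b` by a step of at most
  -- `M`.
  obtain ⟨p, hp, h3, h4, h5⟩ := exists_greatest_mem (B := {p | p ∈ A ∧ T p ≤ b}) (u := x) (t := y)
    ⟨hx, by omega⟩ hxy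
  refine ⟨p, hp.1, h3, h4, ?_, by have := hp.2; omega⟩
  rcases h4.eq_or_lt with rfl | h6
  · omega
  · obtain ⟨p', ha, hp'⟩ := exists_next hp.1 hy h6
    have h7 := hstep p p' ha h3 hp'
    by_contra hlt
    have := h5 p' ⟨ha.2.1, by omega⟩ hp'
    have := ha.2.2.1
    omega

section Slow

open Classical in
/-- The set of indices of the blocks of length `l` after `x` that contain a point of
`A ∩ [x, p]`. -/
noncomputable def blocksUpTo (A : Set ℕ) (l x p : ℕ) : Finset ℕ :=
  ((Finset.Icc x p).filter (· ∈ A)).image (fun z => (z - x) / l)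

theorem mem_blocksUpTo {A : Set ℕ} {l x p j : ℕ} :
    j ∈ blocksUpTo A l x p ↔ ∃ z ∈ A, x ≤ z ∧ z ≤ p ∧ (z - x) / l = j := by
  simp only [blocksUpTo, Finset.mem_image, Finset.mem_filter, Finset.mem_Icc]
  constructor
  · rintro ⟨z, ⟨⟨h1, h2⟩, h3⟩, h4⟩; exact ⟨z, h3, h1, h2, h4⟩
  · rintro ⟨z, h3, h1, h2, h4⟩; exact ⟨z, ⟨⟨h1, h2⟩, h3⟩, h4⟩

theorem blocksUpTo_mono {A : Set ℕ} {l x p p' : ℕ} (h : p ≤ p') :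
    blocksUpTo A l x p ⊆ blocksUpTo A l x p' := by
  intro j hj
  rw [mem_blocksUpTo] at hj ⊢
  obtain ⟨z, h1, h2, h3, h4⟩ := hj
  exact ⟨z, h1, h2, h3.trans h, h4⟩

theorem blocksUpTo_self {A : Set ℕ} {l x : ℕ} (hx : x ∈ A) : blocksUpTo A l x x = {0} := by
  ext j
  rw [mem_blocksUpTo, Finset.mem_singleton]
  constructor
  · rintro ⟨z, -, h2, h3, h4⟩
    rw [← h4, show z - x = 0 by omega, Nat.zero_div]
  · rintro rfl
    exact ⟨x, hx, le_rfl, le_rfl, by simp⟩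

theorem card_blocksUpTo_le {A : Set ℕ} {l x p : ℕ} :
    (blocksUpTo A l x p).card ≤ (p - x) / l + 1 := by
  have : blocksUpTo A l x p ⊆ Finset.range ((p - x) / l + 1) := by
    intro j hj
    obtain ⟨z, -, -, h3, rfl⟩ := mem_blocksUpTo.1 hj
    rw [Finset.mem_range]
    have := Nat.div_le_div_right (c := l) (show z - x ≤ p - x by omega)
    omega
  simpa using Finset.card_le_card this

theorem card_blocksUpTo_adj {A : Set ℕ} {l x p p' : ℕ} (h : AdjIn A p p') :
    (blocksUpTo A l x p').card ≤ (blocksUpTo A l x p).card + 1 := by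
  have : blocksUpTo A l x p' ⊆ insert ((p' - x) / l) (blocksUpTo A l x p) := by
    intro j hj
    obtain ⟨z, h1, h2, h3, rfl⟩ := mem_blocksUpTo.1 hj
    rw [Finset.mem_insert]
    rcases h.2.2.2 z h1 with h4 | h4
    · exact Or.inr (mem_blocksUpTo.2 ⟨z, h1, h2, h4, rfl⟩)
    · left; congr 2; omega
  exact (Finset.card_le_card this).trans (Finset.card_insert_le _ _)

/-- Fibres of the slow map are short: if no new block is met between `p` and `p'`, then `p'` shares
its block with a point not beyond `p`. -/
theorem le_add_of_card_blocksUpTo_eq {A : Set ℕ} {l x p p' : ℕ} (hl : 0 < l) (hp' : p' ∈ A)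
    (hxp : x ≤ p) (hpp : p ≤ p') (h : (blocksUpTo A l x p).card = (blocksUpTo A l x p').card) :
    p' ≤ p + l := by
  have heq := Finset.eq_of_subset_of_card_le (blocksUpTo_mono (A := A) (l := l) (x := x) hpp) h.ge
  have hmem : (p' - x) / l ∈ blocksUpTo A l x p' :=
    mem_blocksUpTo.2 ⟨p', hp', hxp.trans hpp, le_rfl, rfl⟩
  rw [← heq, mem_blocksUpTo] at hmem
  obtain ⟨z, -, h2, h3, h4⟩ := hmem
  have e1 := Nat.div_add_mod (p' - x) l
  have e2 := Nat.div_add_mod (z - x) l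
  rw [h4] at e2
  have := Nat.mod_lt (p' - x) hl
  omega

end Slow

section Fast

theorem countIn_Ioc_adj {A : Set ℕ} {p p' y : ℕ} (h : AdjIn A p p') (hy : p' ≤ y) :
    countIn A (Finset.Ioc p y) = countIn A (Finset.Ioc p' y) + 1 := by
  classical
  unfold countIn
  have : (Finset.Ioc p y).filter (· ∈ A) = insert p' ((Finset.Ioc p' y).filter (· ∈ A)) := by
    ext z
    simp only [Finset.mem_filter, Finset.mem_Ioc, Finset.mem_insert]
    have := h.2.2.1
    constructor
    · rintro ⟨⟨h1, h2⟩, h3⟩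
      rcases h.2.2.2 z h3 with h4 | h4
      · omega
      · rcases h4.eq_or_lt with rfl | h4
        · exact Or.inl rfl
        · exact Or.inr ⟨⟨h4, h2⟩, h3⟩
    · rintro (rfl | ⟨⟨h1, h2⟩, h3⟩)
      · exact ⟨⟨this, hy⟩, h.2.1⟩
      · exact ⟨⟨by omega, h2⟩, h3⟩
  rw [this, Finset.card_insert_of_notMem (by simp)]

theorem countIn_mono {A : Set ℕ} {s t : Finset ℕ} (h : s ⊆ t) : countIn A s ≤ countIn A t := by
  classical
  exact Finset.card_le_card (Finset.filter_subset_filter _ h)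

end Fast

theorem exists_mem_ge_of_short {B : Set ℕ} {g u v : ℕ} (hu : u ∈ B)
    (hshort : ∀ b ∈ B, u ≤ b → b < v → ∃ b' ∈ B, b < b' ∧ b' ≤ b + g) {t : ℕ} (h1 : u ≤ t)
    (h2 : t < v) : ∃ b ∈ B, t ≤ b ∧ b ≤ t + g := by
  obtain ⟨b, hb, h3, h4, h5⟩ := exists_greatest_mem hu h1
  rcases h4.eq_or_lt with rfl | h4
  · exact ⟨b, hb, le_rfl, by omega⟩
  · obtain ⟨b', hb', h6, h7⟩ := hshort b hb h3 (by omega)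
    refine ⟨b', hb', ?_, by omega⟩
    by_contra hlt
    have := h5 b' hb' (by omega)
    omega

theorem exists_mem_le_of_short {B : Set ℕ} {g u v : ℕ} (hu : u ∈ B) (hv : v ∈ B)
    (hshort : ∀ b ∈ B, u ≤ b → b < v → ∃ b' ∈ B, b < b' ∧ b' ≤ b + g) {t : ℕ} (h1 : u ≤ t)
    (h2 : t ≤ v) : ∃ b ∈ B, u ≤ b ∧ b ≤ t ∧ t ≤ b + g := by
  obtain ⟨b, hb, h3, h4, h5⟩ := exists_greatest_mem hu h1
  refine ⟨b, hb, h3, h4, ?_⟩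
  rcases h2.eq_or_lt with rfl | h2
  · have := h5 t hv le_rfl
    omega
  · obtain ⟨b', hb', h6, h7⟩ := hshort b hb h3 (by omega)
    by_contra hlt
    have := h5 b' hb' (by omega)
    omega

/-- Stepping stones for the slow map: advance by `j`, then go on to a point of `B` within `g`.
Nothing is claimed about the terms once `v` may have been reached. -/
theorem exists_forward_seq {B : Set ℕ} {j g u v : ℕ}
    (hup : ∀ t, u ≤ t → t < v → ∃ b ∈ B, t ≤ b ∧ b ≤ t + g) :
    ∃ c : ℕ → ℕ, c 0 = u ∧ ∀ i, u + (j + g) * (i + 1) < v →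
      c (i + 1) ∈ B ∧ c i + j ≤ c (i + 1) ∧ c (i + 1) ≤ c i + (j + g) := by
  choose! nx hnx using hup
  let c : ℕ → ℕ := fun i => Nat.rec u (fun _ b => nx (b + j)) i
  have hc : ∀ i, c (i + 1) = nx (c i + j) := fun i => rfl
  have key : ∀ i, (u ≤ c i ∧ c i ≤ u + (j + g) * i ∨ v ≤ u + (j + g) * i) := by
    intro i
    induction i with
    | zero => left; simp [c]
    | succ i ih =>
      by_cases hv : v ≤ u + (j + g) * (i + 1)
      · exact Or.inr hv
      · left
        rw [Nat.mul_succ] at hv ⊢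
        rcases ih with ⟨h1, h2⟩ | h
        · have := hnx (c i + j) (by omega) (by omega)
          rw [hc]; omega
        · omega
  refine ⟨c, rfl, fun i hi => ?_⟩
  have hk := key i
  rw [Nat.mul_succ] at hi
  rcases hk with ⟨h1, h2⟩ | h
  · have := hnx (c i + j) (by omega) (by omega)
    rw [hc]
    exact ⟨this.1, this.2.1, by omega⟩
  · omega

/-- Stepping stones for the fast map, numbered backwards from `v`. When fewer than `j` integers are
left the sequence drops to `u` and stays there, so the lower bound `j` on a step is claimed only
while the sequence is above `u`. -/
theorem exists_backward_seq {B : Set ℕ} {j g u v : ℕ} (hj : 0 < j) (hu : u ∈ B) (hv : v ∈ B)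
    (huv : u ≤ v)
    (hdown : ∀ t, u ≤ t → t ≤ v → ∃ b ∈ B, u ≤ b ∧ b ≤ t ∧ t ≤ b + g) :
    ∃ w : ℕ → ℕ, w 0 = v ∧ (∀ i, w i ∈ B) ∧ (∀ i, u ≤ w i) ∧ (∀ i, w (i + 1) ≤ w i) ∧
      (∀ i, w i ≤ w (i + 1) + (j + g)) ∧ (∀ i, u < w (i + 1) → w (i + 1) + j ≤ w i) ∧
      (∀ i, u < w i → w (i + 1) < w i) ∧ (∀ i, w i = u ∨ w i + j * i ≤ v) := by
  choose! pv hpv using hdown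
  let w : ℕ → ℕ := fun i => Nat.rec (motive := fun _ => ℕ) v
    (fun _ b => if u + j ≤ b then pv (b - j) else u) i
  have hw : ∀ i : ℕ, w (i + 1) = if u + j ≤ w i then pv (w i - j) else u := fun i => rfl
  have key : ∀ i, w i ∈ B ∧ u ≤ w i ∧ w i ≤ v := by
    intro i
    induction i with
    | zero => exact ⟨hv, huv, le_rfl⟩
    | succ i ih =>
      rw [hw]
      split_ifs with h
      · have := hpv (w i - j) (by omega) (by omega)
        exact ⟨this.1, this.2.1, by omega⟩
      · exact ⟨hu, le_rfl, huv⟩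
  have step : ∀ i, w (i + 1) ≤ w i ∧ w i ≤ w (i + 1) + (j + g) ∧
      (u < w (i + 1) → w (i + 1) + j ≤ w i) ∧ (u < w i → w (i + 1) < w i) := by
    intro i
    have hk := key i
    rw [hw]
    split_ifs with h
    · have := hpv (w i - j) (by omega) (by omega)
      omega
    · omega
  refine ⟨w, rfl, fun i => (key i).1, fun i => (key i).2.1, fun i => (step i).1,
    fun i => (step i).2.1, fun i => (step i).2.2.1, fun i => (step i).2.2.2, ?_⟩
  intro i
  induction i with
  | zero => right; simp [w]
  | succ i ih =>
    have hs := step i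
    have hk := key i
    have hk' := key (i + 1)
    rw [Nat.mul_succ]
    rcases ih with h | h <;> omega

/-- If the gaps of `B` between `u` and `v` are at most `180 q` and the gaps of `A` between `x` and
`y` at most `800 q²`, then `A ∩ [x, y]` can be mapped to `B ∩ [u, v]`, provided `y - x` is neither
too large nor `A ∩ [x, y]` too small compared to `v - u`. -/
theorem exists_segMap_of_short {A B : Set ℕ} {q x y u v : ℕ} (hq : 0 < q) (hx : x ∈ A) (hy : y ∈ A)
    (hu : u ∈ B) (hv : v ∈ B) (hxy : x ≤ y) (huv : u < v)
    (hshort : ∀ b ∈ B, u ≤ b → b < v → ∃ b' ∈ B, b < b' ∧ b' ≤ b + 180 * q)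
    (hgap : ∀ p p', AdjIn A p p' → x ≤ p → p' ≤ y → p' ≤ p + 800 * q ^ 2)
    (hslow : u + 184 * q * ((y - x) / (200 * q)) < v)
    (hfast : v ≤ u + 20 * q * countIn A (Finset.Ioc x y)) :
    ∃ T, SegMap A B (200 * q) x y u v T := by
  -- Steps of `c` lie between `4 q` and `184 q`, those of `w` are at most `200 q` and, above `u`, at
  -- least `20 q`. A step of `4 q` already allows a gap of `200 q * 4 q = 800 q²` in `A`.
  obtain ⟨c, hc0, hc⟩ := exists_forward_seq (j := 4 * q)
    (fun t h1 h2 => exists_mem_ge_of_short hu hshort h1 h2)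
  obtain ⟨w, hw0, hwB, hwu, hwle, hwstep, hwj, hwlt, hwv⟩ := exists_backward_seq
    (j := 20 * q) (by omega) hu hv huv.le
    (fun t h1 h2 => exists_mem_le_of_short hu hv hshort h1 h2)
  set l := 200 * q with hl
  have hlpos : 0 < l := by omega
  -- The index of the slow map: blocks met so far, not counting the block of `x`.
  let N : ℕ → ℕ := fun p => (blocksUpTo A l x p).card - 1
  have hcard : ∀ p, x ≤ p → 1 ≤ (blocksUpTo A l x p).card := fun p hp =>
    Finset.card_pos.2 ⟨_, mem_blocksUpTo.2 ⟨x, hx, le_rfl, hp, rfl⟩⟩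
  have hNmono : ∀ p p', p ≤ p' → N p ≤ N p' := fun p p' h =>
    Nat.sub_le_sub_right (Finset.card_le_card (blocksUpTo_mono h)) 1
  have hNx : N x = 0 := by simp [N, blocksUpTo_self hx]
  have hNy : u + (4 * q + 180 * q) * N y < v := by
    refine lt_of_le_of_lt ?_ hslow
    have h1 : N y ≤ (y - x) / l := by
      have := card_blocksUpTo_le (A := A) (l := l) (x := x) (p := y)
      exact Nat.sub_le_of_le_add this
    have := Nat.mul_le_mul_left (184 * q) h1
    rw [show 4 * q + 180 * q = 184 * q by ring]
    exact Nat.add_le_add_left this u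
  have hNadj : ∀ p p', AdjIn A p p' → x ≤ p → N p' = N p ∨ N p' = N p + 1 := by
    intro p p' ha hp
    have h1 := card_blocksUpTo_adj (l := l) (x := x) ha
    have h2 := hNmono p p' ha.2.2.1.le
    have h3 := hcard p hp
    simp only [N] at h2 ⊢
    omega
  have hNfib : ∀ p p', p' ∈ A → x ≤ p → p ≤ p' → N p = N p' → p' ≤ p + l := by
    intro p p' hp' h1 h2 h3
    refine le_add_of_card_blocksUpTo_eq hlpos hp' h1 h2 ?_
    have h4 := hcard p h1
    have h5 := hcard p' (h1.trans h2)
    simp only [N] at h3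
    omega
  have hcs : ∀ i, i + 1 ≤ N y → c (i + 1) ∈ B ∧ c i + 4 * q ≤ c (i + 1) ∧
      c (i + 1) ≤ c i + 184 * q := by
    intro i hi
    have h1 := hc i (lt_of_le_of_lt (by gcongr) hNy)
    rw [show 4 * q + 180 * q = 184 * q by ring] at h1
    exact h1
  have hcB : ∀ i, i ≤ N y → c i ∈ B := by
    intro i hi
    cases i with
    | zero => rwa [hc0]
    | succ i => exact (hcs i hi).1
  have hcmono : ∀ i k, i ≤ k → k ≤ N y → c i + (k - i) ≤ c k := by
    intro i k hik
    induction k, hik using Nat.le_induction with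
    | base => intro _; omega
    | succ k hik ih =>
      intro hk
      have := ih (by omega)
      have := hcs k hk
      omega
  have hcu : ∀ i, i ≤ N y → u ≤ c i := by
    intro i hi
    have := hcmono 0 i (Nat.zero_le _) hi
    omega
  have hcv : ∀ i, i ≤ N y → c i < v := by
    have h1 : ∀ i, i ≤ N y → c i ≤ u + 184 * q * i := by
      intro i
      induction i with
      | zero => intro _; omega
      | succ i ih =>
        intro hi
        have := ih (by omega)
        have := hcs i hi
        rw [Nat.mul_succ]
        omega
    intro i hi
    have h2 := h1 i hi
    have h3 := Nat.mul_le_mul_left (184 * q) hi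
    rw [show 4 * q + 180 * q = 184 * q by ring] at hNy
    omega
  -- The index of the fast map: points of `A` still to come, so that `y` has index `0` and image
  -- `v`.
  let r : ℕ → ℕ := fun p => countIn A (Finset.Ioc p y)
  have hradj : ∀ p p', AdjIn A p p' → p' ≤ y → r p = r p' + 1 := fun p p' ha h =>
    countIn_Ioc_adj ha h
  have hry : r y = 0 := by simp [r, countIn]
  have hrlt : ∀ p p', p' ∈ A → p < p' → p' ≤ y → r p' < r p := by
    classical
    intro p p' hp' h1 h2
    refine Finset.card_lt_card ?_
    refine Finset.ssubset_iff_subset_ne.2 ⟨Finset.filter_subset_filter _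
      (Finset.Ioc_subset_Ioc_left h1.le), fun heq => ?_⟩
    have : p' ∈ (Finset.Ioc p y).filter (· ∈ A) := by simp [hp', h1, h2]
    rw [← heq] at this
    simp at this
  have hwanti : ∀ i k, i ≤ k → w k ≤ w i := fun i k h => antitone_nat_of_succ_le hwle h
  -- By `hfast` there are enough points for steps of `20 q` to run from `v` down to `u`.
  have hwx : w (r x) = u := by
    rcases hwv (r x) with h | h
    · exact h
    · have := hwu (r x)
      have : v ≤ u + 20 * q * r x := hfast
      omega
  have hwsd : ∀ i k, i < k → u < w i → w k < w i := by
    intro i k hik hi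
    have h1 := hwanti (i + 1) k hik
    have h2 := hwlt i hi
    omega
  have hwv' : ∀ i, 0 < i → w i < v := by
    intro i hi
    have := hwsd 0 i hi (by omega)
    omega
  have hq2 : 800 * q ^ 2 = l * (4 * q) := by rw [hl]; ring
  -- The slow map bounds the fibres, and the fast map makes sure that `v` is reached. Both start at
  -- `u`.
  refine ⟨fun p => max (c (N p)) (w (r p)), hxy, hx, hy, ?_, ?_, ?_, ?_, ?_, ?_, ?_, ?_, ?_⟩
  · simp only [hNx, hc0, hwx, max_self]
  · simp only [hry, hw0]
    exact max_eq_right (hcv _ le_rfl).le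
  · intro p hp h1 h2
    rcases max_choice (c (N p)) (w (r p)) with h | h
    · simp only [h]; exact hcB _ (hNmono p y h2)
    · simp only [h]; exact hwB _
  · intro p hp p' hp' h1 h2 h3
    refine max_le_max ?_ ?_
    · have := hcmono (N p) (N p') (hNmono p p' h2) (hNmono p' y h3)
      omega
    · rcases h2.eq_or_lt with rfl | h2
      · exact le_rfl
      · exact hwanti _ _ (hrlt p p' hp' h2 h3).le
  · intro p p' ha h1 h2
    have hlt := ha.2.2.1
    have hg := hgap p p' ha h1 h2
    have hN := hNadj p p' ha h1
    have hN' := hNmono p' y h2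
    have hr := hradj p p' ha h2
    have hj := hwj (r p')
    have hle := hwle (r p')
    rw [← hr] at hj hle
    have hus := hcu (N p) (by omega)
    have big : ∀ s t, s + 4 * q ≤ t → p' + l * s ≤ p + l * t := by
      intro s t hst
      have := Nat.mul_le_mul_left l hst
      rw [Nat.mul_add] at this
      omega
    intro hne
    -- A step below `4 q` occurs only when the fast map overtakes the slow one inside a block; then
    -- `p' ≤ p + 200 q`, and a step of `1` suffices.
    rcases le_or_gt (w (r p)) (c (N p)) with hcw | hcw
    · rcases hN with hN | hN
      · have hf := hNfib p p' ha.2.1 h1 hlt.le hN.symm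
        rw [hN] at hne ⊢
        have h3 : c (N p) + 1 ≤ max (c (N p)) (w (r p')) := by omega
        have h4 := Nat.mul_le_mul_left l h3
        rw [max_eq_left hcw]
        rw [Nat.mul_add] at h4
        omega
      · apply big
        have := hcs (N p) (by omega)
        rw [hN]
        omega
    · apply big
      have := hwj (r p')
      rw [← hr] at this
      have := hwlt (r p) (by omega)
      have h5 : u < w (r p) := by omega
      omega
  · intro p p' ha h1 h2
    have hlt := ha.2.2.1
    have hN := hNadj p p' ha h1
    have hN' := hNmono p' y h2
    have hr := hradj p p' ha h2
    have hs := hwstep (r p')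
    rw [← hr] at hs
    have h3 : c (N p') ≤ c (N p) + l := by
      rcases hN with hN | hN
      · rw [hN]; omega
      · rw [hN]
        have := hcs (N p) (by omega)
        omega
    have h4 : max (c (N p')) (w (r p')) ≤ max (c (N p)) (w (r p)) + l := by omega
    have h5 : l * p + l ≤ l * p' := by
      have := Nat.mul_le_mul_left l (show p + 1 ≤ p' by omega)
      rwa [Nat.mul_add, Nat.mul_one] at this
    omega
  · intro p hp p' hp' h1 h2 h3 heq
    replace heq : max (c (N p)) (w (r p)) = max (c (N p')) (w (r p')) := heq
    rcases h2.eq_or_lt with rfl | h2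
    · omega
    have hN := hNmono p p' h2.le
    have hN' := hNmono p' y h3
    have hc' := hcmono (N p) (N p') hN hN'
    have hus := hcu (N p) (by omega)
    have hr := hrlt p p' hp' h2 h3
    have hw' := hwsd (r p') (r p) hr
    have hwa := hwanti (r p') (r p) hr.le
    have hwu' := hwu (r p)
    -- The slow map is strictly increasing in `N`, and the fast one is strictly increasing once
    -- above `u`. Equal maxima therefore force equal `N`.
    refine hNfib p p' hp' h1 h2.le ?_
    omega
  · intro p hp h1 h2
    refine max_lt (hcv _ (hNmono p y h2.le)) (hwv' _ ?_)
    have := hrlt p y hy h2 le_rfl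
    omega
  · refine dense_of_steps hx hy ?_ ?_ hxy ?_
    · simp only [hNx, hc0, hwx, max_self]
    · simp only [hry, hw0]
      exact max_eq_right (hcv _ le_rfl).le
    · intro p p' ha h1 h2
      have hN := hNadj p p' ha h1
      have hN' := hNmono p' y h2
      have hr := hradj p p' ha h2
      have hs := hwstep (r p')
      rw [← hr] at hs
      have h3 : c (N p') ≤ c (N p) + l := by
        rcases hN with hN | hN
        · rw [hN]; omega
        · rw [hN]
          have := hcs (N p) (by omega)
          omega
      omega

/-! ### Dense sets and long stretches -/

theorem countIn_Ioc_add (A : Set ℕ) {x y z : ℕ} (hxy : x ≤ y) (hyz : y ≤ z) :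
    countIn A (Finset.Ioc x z) = countIn A (Finset.Ioc x y) + countIn A (Finset.Ioc y z) := by
  classical
  unfold countIn
  rw [← Finset.card_union_of_disjoint, ← Finset.filter_union, Finset.Ioc_union_Ioc_eq_Ioc hxy hyz]
  refine Finset.disjoint_filter_filter (Finset.disjoint_left.2 fun a h1 h2 => ?_)
  rw [Finset.mem_Ioc] at h1 h2
  omega

/-- Every window of `500 q²` consecutive integers to the right of a point below `L` contains at least
`100 q` points of `A`. -/
def DenseBelow (q L : ℕ) (A : Set ℕ) : Prop :=
  ∀ x < L, 100 * q ≤ countIn A (Finset.Ioc x (x + 500 * q ^ 2))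

theorem DenseBelow.countIn_ge {q L : ℕ} {A : Set ℕ} (h : DenseBelow q L A) {x : ℕ} (k : ℕ)
    (hL : x + 500 * q ^ 2 * k ≤ L) (hq : 0 < q) :
    100 * q * k ≤ countIn A (Finset.Ioc x (x + 500 * q ^ 2 * k)) := by
  induction k with
  | zero => simp
  | succ k ih =>
    have hq2 : 0 < q ^ 2 := by positivity
    rw [Nat.mul_succ (500 * q ^ 2)] at hL ⊢
    have h1 := ih (by omega)
    have h2 := h (x + 500 * q ^ 2 * k) (by omega)
    rw [countIn_Ioc_add A (y := x + 500 * q ^ 2 * k) (by omega) (by omega),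
      Nat.mul_succ (100 * q)]
    rw [add_assoc] at h2
    omega

theorem DenseBelow.countIn_ge_div {q L : ℕ} {A : Set ℕ} (h : DenseBelow q L A) {x y : ℕ}
    (hxy : x ≤ y) (hL : y ≤ L) (hq : 0 < q) :
    100 * q * ((y - x) / (500 * q ^ 2)) ≤ countIn A (Finset.Ioc x y) := by
  have h1 := Nat.mul_div_le (y - x) (500 * q ^ 2)
  refine (h.countIn_ge ((y - x) / (500 * q ^ 2)) (x := x) (by omega) hq).trans (countIn_mono ?_)
  exact Finset.Ioc_subset_Ioc_right (by omega)

theorem DenseBelow.gap_le {q L : ℕ} {A : Set ℕ} (h : DenseBelow q L A) (hq : 0 < q) {p p' : ℕ}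
    (ha : AdjIn A p p') (hp : p < L) : p' ≤ p + 800 * q ^ 2 := by
  classical
  have h1 := h p hp
  have h2 : 0 < countIn A (Finset.Ioc p (p + 500 * q ^ 2)) := by omega
  obtain ⟨z, hz⟩ := Finset.card_pos.1 h2
  simp only [Finset.mem_filter, Finset.mem_Ioc] at hz
  rcases ha.2.2.2 z hz.2 with h3 | h3 <;> omega

/-- Every point of `B` in `[u, v)` is followed by another one at distance at most `180 q`. -/
def ShortGaps (q : ℕ) (B : Set ℕ) (u v : ℕ) : Prop :=
  ∀ b ∈ B, u ≤ b → b < v → ∃ b' ∈ B, b < b' ∧ b' ≤ b + 180 * q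

/-- The slow map is slow enough because `184 < 200`. The fast map is fast enough because each window
of `500 q²` integers holds `100 q` points, worth `20 q` each, hence `2000 q²`; a factor `2` is lost
to `h2` and another to rounding. The permitted range of `y - x` is what later absorbs waiting times.
-/
theorem exists_segMap_of_long {A B : Set ℕ} {q L x y u v : ℕ} (hq : 0 < q)
    (hA : DenseBelow q L A) (hx : x ∈ A) (hy : y ∈ A) (hu : u ∈ B) (hv : v ∈ B) (hxy : x ≤ y)
    (hL : y ≤ L) (hshort : ShortGaps q B u v) (hd : u + 1000 * q ^ 2 ≤ v)
    (h1 : y - x ≤ v - u) (h2 : v - u ≤ 2 * (y - x)) :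
    ∃ T, SegMap A B (200 * q) x y u v T := by
  have hq2 : 0 < q ^ 2 := by positivity
  refine exists_segMap_of_short hq hx hy hu hv hxy (by omega) hshort ?_ ?_ ?_
  · intro p p' ha _ hp'
    exact hA.gap_le hq ha (by have := ha.2.2.1; omega)
  · have h3 := Nat.mul_div_le (y - x) (200 * q)
    rcases Nat.eq_zero_or_pos ((y - x) / (200 * q)) with h4 | h4
    · rw [h4]; omega
    · have h5 : 184 * q * ((y - x) / (200 * q)) < 200 * q * ((y - x) / (200 * q)) :=
        Nat.mul_lt_mul_of_pos_right (by omega) h4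
      omega
  · have h3 := hA.countIn_ge_div hxy hL hq
    set k := (y - x) / (500 * q ^ 2) with hk
    have h4 : y - x < 500 * q ^ 2 * (k + 1) := Nat.lt_mul_div_succ _ (by omega)
    have h5 : 1 ≤ k := (Nat.one_le_div_iff (by omega)).2 (by omega)
    have h6 : 20 * q * (100 * q * k) ≤ 20 * q * countIn A (Finset.Ioc x y) :=
      Nat.mul_le_mul_left _ h3
    have h7 : 20 * q * (100 * q * k) = 2000 * (q ^ 2 * k) := by ring
    have h8 : 500 * q ^ 2 * (k + 1) = 500 * (q ^ 2 * k) + 500 * q ^ 2 := by ring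
    have h9 : q ^ 2 * 1 ≤ q ^ 2 * k := Nat.mul_le_mul_left _ h5
    omega

/-! ### Clusters of long gaps and their patterns -/

/-- The length of the gap of `A` used for a gap of `B` of length `h`. -/
def gapLen (q h : ℕ) : ℕ := (h + 200 * q - 1) / (200 * q)

/-- The number of points of `A` used to cover a stretch of `B` of length `d`. -/
def coverCount (q d : ℕ) : ℕ := (d + 20 * q - 1) / (20 * q)

/-- The length of the stretch of `A` used for a stretch of `B` of length `d` between two gaps. -/
def spacing (q d : ℕ) : ℕ :=
  if d = 0 then 0 else if d ≤ 1000 * q ^ 2 then 2 * coverCount q d + 1 else d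

theorem ceil_div_bounds {m : ℕ} (hm : 0 < m) (h : ℕ) :
    h ≤ m * ((h + m - 1) / m) ∧ m * ((h + m - 1) / m) ≤ h + m - 1 := by
  have h1 := Nat.mul_div_le (h + m - 1) m
  have h2 : h + m - 1 < m * ((h + m - 1) / m + 1) := Nat.lt_mul_div_succ _ hm
  rw [Nat.mul_succ] at h2
  omega

theorem ceil_div_le_self {m h : ℕ} (hm : 0 < m) : (h + m - 1) / m ≤ h := by
  rw [Nat.div_le_iff_le_mul_add_pred hm]
  have := Nat.mul_le_mul_right h (show 1 ≤ m from hm)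
  omega

theorem spacing_le {q : ℕ} (hq : 0 < q) (d : ℕ) : spacing q d ≤ 3 * d := by
  unfold spacing coverCount
  have := ceil_div_le_self (m := 20 * q) (h := d) (by omega)
  split_ifs <;> omega

/-- The part of the pattern in `A`, starting at `y`, that corresponds to a gap of length `h` in `B`
followed by a stretch of length `d`. -/
def HeadFits (q : ℕ) (A : Set ℕ) (y h d : ℕ) : Prop :=
  (y ∈ A ∧ (∀ z, y < z → z < y + gapLen q h → z ∉ A) ∧ (0 < d → y + gapLen q h ∈ A)) ∧
    (0 < d → d ≤ 1000 * q ^ 2 → coverCount q d ≤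
      countIn A (Finset.Ioo (y + gapLen q h) (y + gapLen q h + (2 * coverCount q d + 1))))

/-- The pattern corresponding to a list of gaps and stretches of `B` occurs in `A` at `y`. -/
def Fits (q : ℕ) (A : Set ℕ) : ℕ → List (ℕ × ℕ) → Prop
  | y, [] => y ∈ A
  | y, e :: l => HeadFits q A y e.1 e.2 ∧ Fits q A (y + gapLen q e.1 + spacing q e.2) l

theorem Fits.mem {q : ℕ} {A : Set ℕ} {y : ℕ} {l : List (ℕ × ℕ)} (h : Fits q A y l) : y ∈ A := by
  cases l with
  | nil => exact h
  | cons e l => exact h.1.1.1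

/-- Starting at `v` the gaps of `B` longer than `180 q` and the stretches between them are those
listed, up to the point `w`. -/
def Chain (q : ℕ) (B : Set ℕ) : ℕ → List (ℕ × ℕ) → ℕ → Prop
  | v, [], w => v = w
  | v, e :: l, w => AdjIn B v (v + e.1) ∧ v + e.1 + e.2 ∈ B ∧
      ShortGaps q B (v + e.1) (v + e.1 + e.2) ∧ Chain q B (v + e.1 + e.2) l w

/-- The admissible lists of long gaps and stretches. -/
def Admissible (q : ℕ) (l : List (ℕ × ℕ)) : Prop :=
  ∀ e ∈ l, 180 * q < e.1 ∧ e.1 ≤ 800 * q ^ 2 ∧ e.2 < 2 ^ (18 * q)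

theorem Chain.le {q : ℕ} {B : Set ℕ} {l : List (ℕ × ℕ)} :
    ∀ {v w : ℕ}, Chain q B v l w → v ≤ w := by
  induction l with
  | nil => intro v w h; exact Nat.le_of_eq h
  | cons e l ih =>
    intro v w h
    have := ih h.2.2.2
    omega

/-- If the pattern of a stretch of `B` occurs in `A`, then this occurrence can be mapped to it. -/
theorem exists_segMap_of_chain {A B : Set ℕ} {q L : ℕ} (hq : 0 < q) (hA : DenseBelow q L A)
    {l : List (ℕ × ℕ)} : ∀ {y v w : ℕ}, (∀ e ∈ l, 180 * q < e.1 ∧ e.1 ≤ 800 * q ^ 2) →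
      v ∈ B → Fits q A y l → Chain q B v l w → y + 3 * (w - v) ≤ L →
      ∃ y' T, SegMap A B (200 * q) y y' v w T ∧ y' ≤ y + 3 * (w - v) := by
  induction l with
  | nil =>
    intro y v w _ hv hF hC _
    obtain rfl : v = w := hC
    exact ⟨y, _, SegMap.refl _ hF hv, by omega⟩
  | cons e l ih =>
    obtain ⟨h, d⟩ := e
    intro y v w hl hv hF hC hL
    obtain ⟨hAdj, hmem, hshort, hC'⟩ := hC
    obtain ⟨⟨⟨hyA, hzero, hend⟩, hcount⟩, hF'⟩ := hF
    have hh := hl (h, d) (by simp)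
    dsimp only at *
    have hvw := hC'.le
    have hgap1 := ceil_div_bounds (m := 200 * q) (by omega) h
    have hgap2 := ceil_div_le_self (m := 200 * q) (h := h) (by omega)
    have hgaplen : gapLen q h = (h + 200 * q - 1) / (200 * q) := rfl
    have hsp := spacing_le hq d
    rw [← hgaplen] at hgap1 hgap2
    have hapos : 0 < gapLen q h := by
      rcases Nat.eq_zero_or_pos (gapLen q h) with h0 | h0
      · rw [h0] at hgap1; omega
      · exact h0
    set a := gapLen q h with ha
    -- For `d = 0` the rest of the pattern starts at `y + a` and itself supplies this point.
    have hyaA : y + a ∈ A := by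
      rcases Nat.eq_zero_or_pos d with rfl | hd
      · simpa [spacing] using hF'.mem
      · exact hend hd
    obtain ⟨T₀, hstep⟩ : ∃ T, SegMap A B (200 * q) y (y + a) v (v + h) T := by
      refine ⟨_, segMap_step ⟨hyA, hyaA, by omega, ?_⟩ hAdj ?_ ?_⟩
      · intro z hz
        by_contra hcon
        exact hzero z (by omega) (by omega) hz
      · have := Nat.mul_le_mul_right h (show 1 ≤ 200 * q by omega)
        rw [Nat.add_sub_cancel_left, Nat.add_sub_cancel_left]
        omega
      · rw [Nat.add_sub_cancel_left, Nat.add_sub_cancel_left]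
        exact hgap1.1
    obtain ⟨y', T', hT', hy'⟩ := ih (fun e he => hl e (List.mem_cons_of_mem _ he)) hmem hF' hC'
      (by omega)
    have hmid : ∃ T, SegMap A B (200 * q) (y + a) (y + a + spacing q d) (v + h) (v + h + d) T := by
      rcases Nat.eq_zero_or_pos d with rfl | hd
      · exact ⟨_, by simpa [spacing] using SegMap.refl _ hyaA hAdj.2.1⟩
      · rcases le_or_gt d (1000 * q ^ 2) with hd' | hd'
        · have hc := hcount hd hd'
          have hs : spacing q d = 2 * coverCount q d + 1 := by
            unfold spacing; rw [if_neg (by omega), if_pos hd']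
          have hcov := ceil_div_bounds (m := 20 * q) (by omega) d
          have hcov' : coverCount q d = (d + 20 * q - 1) / (20 * q) := rfl
          rw [← hcov'] at hcov
          have hcle : coverCount q d ≤ 50 * q := by
            have h1 : 20 * q * coverCount q d < 20 * q * (50 * q + 1) := by
              have : 20 * q * (50 * q + 1) = 1000 * q ^ 2 + 20 * q := by ring
              omega
            exact Nat.lt_succ_iff.1 (Nat.lt_of_mul_lt_mul_left h1)
          refine exists_segMap_of_short hq hyaA hF'.mem hAdj.2.1 hmem (by omega) (by omega) hshort
            ?_ ?_ ?_
          · intro p p' had _ hp'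
            exact hA.gap_le hq had (by have := had.2.2.1; omega)
          -- A compressed stretch has length at most `101 q < 200 q`, so the slow map is not
          -- required to move.
          · rw [Nat.div_eq_of_lt (by omega)]
            omega
          · have h1 : coverCount q d ≤
                countIn A (Finset.Ioc (y + a) (y + a + spacing q d)) := by
              refine hc.trans (countIn_mono ?_)
              rw [hs]
              exact Finset.Ioo_subset_Ioc_self
            have h2 := Nat.mul_le_mul_left (20 * q) h1
            omega
        · have hs : spacing q d = d := by
            unfold spacing; rw [if_neg (by omega), if_neg (by omega)]
          exact exists_segMap_of_long hq hA hyaA hF'.mem hAdj.2.1 hmem (by omega) (by omega) hshort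
            (by omega) (by omega) (by omega)
    obtain ⟨T, hT⟩ := hmid
    exact ⟨y', _, (hstep.trans hT).trans hT', by omega⟩

/-- The integers that are not in `B` if the listed gaps occur in `B` from `v` on. -/
def gapSet : ℕ → List (ℕ × ℕ) → Finset ℕ
  | _, [] => ∅
  | v, e :: l => Finset.Ioo v (v + e.1) ∪ gapSet (v + e.1 + e.2) l

theorem Chain.notMem {q : ℕ} {B : Set ℕ} {l : List (ℕ × ℕ)} :
    ∀ {v w : ℕ}, Chain q B v l w → ∀ z ∈ gapSet v l, z ∉ B := by
  induction l with
  | nil => intro v w _ z hz; simp [gapSet] at hz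
  | cons e l ih =>
    intro v w h z hz
    rw [gapSet, Finset.mem_union, Finset.mem_Ioo] at hz
    rcases hz with hz | hz
    · intro hzB
      rcases h.1.2.2.2 z hzB with h1 | h1 <;> omega
    · exact ih h.2.2.2 z hz

/-- Minus the binary logarithm of a lower bound for the probability of a pattern. -/
def cost (q : ℕ) : List (ℕ × ℕ) → ℕ
  | [] => 1
  | e :: l => gapLen q e.1 + 2 + cost q l

/-- Used to bound the number of gaps in a cluster: `14 q` of them cost more than `14 q`. -/
theorem length_le_cost (q : ℕ) (l : List (ℕ × ℕ)) : 2 * l.length + 1 ≤ cost q l := by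
  induction l with
  | nil => simp [cost]
  | cons e l ih => simp only [cost, List.length_cons]; omega

theorem exists_first_long {q : ℕ} {B : Set ℕ} {u v : ℕ} (h : ¬ ShortGaps q B u v) :
    ∃ b ∈ B, u ≤ b ∧ b < v ∧ (¬ ∃ b' ∈ B, b < b' ∧ b' ≤ b + 180 * q) ∧ ShortGaps q B u b := by
  classical
  have hex : ∃ b, b ∈ B ∧ u ≤ b ∧ b < v ∧ ¬ ∃ b' ∈ B, b < b' ∧ b' ≤ b + 180 * q := by
    unfold ShortGaps at h
    push Not at h
    obtain ⟨b, h1, h2, h3, h4⟩ := h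
    exact ⟨b, h1, h2, h3, by push Not; exact h4⟩
  obtain ⟨h1, h2, h3, h4⟩ := Nat.find_spec hex
  refine ⟨_, h1, h2, h3, h4, ?_⟩
  intro b hb hub hlt
  by_contra hcon
  exact Nat.find_min hex hlt ⟨hb, hub, hlt.trans h3, hcon⟩

/-- A cluster is followed either to its end, marked by a stretch of length `2 ^ (18 q)` free of long
gaps, or through `j` gaps. In the second case only the absent integers are kept, since they alone
make the event improbable. -/
theorem exists_chain_or {q L : ℕ} {B : Set ℕ}
    (hgap : ∀ b < L, ∃ b' ∈ B, b < b' ∧ b' ≤ b + 800 * q ^ 2) (j : ℕ) :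
    ∀ v ∈ B, (¬ ∃ b' ∈ B, v < b' ∧ b' ≤ v + 180 * q) → v + j * (2 ^ (18 * q) + 800 * q ^ 2) ≤ L →
      (∃ l w, Chain q B v l w ∧ w ∈ B ∧ ShortGaps q B w (w + 2 ^ (18 * q)) ∧ l.length ≤ j ∧
        Admissible q l ∧ w ≤ v + j * (2 ^ (18 * q) + 800 * q ^ 2)) ∨
      ∃ l, Admissible q l ∧ l.length = j ∧ ∀ z ∈ gapSet v l, z ∉ B := by
  have hV : 0 < 2 ^ (18 * q) := by positivity
  induction j with
  | zero =>
    intro v _ _ _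
    exact Or.inr ⟨[], by simp [Admissible], rfl, by simp [gapSet]⟩
  | succ j ih =>
    intro v hv hlong hL
    rw [Nat.succ_mul j] at hL ⊢
    obtain ⟨b, hb, hvb, hb'⟩ := hgap v (by omega)
    obtain ⟨v', hadj, hv'⟩ := exists_next hv hb hvb
    obtain ⟨h, rfl⟩ : ∃ h, v' = v + h := ⟨v' - v, by have := hadj.2.2.1; omega⟩
    have hlen : 180 * q < h := by
      by_contra hcon
      exact hlong ⟨v + h, hadj.2.1, hadj.2.2.1, by omega⟩
    by_cases hs : ShortGaps q B (v + h) (v + h + 2 ^ (18 * q))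
    · left
      -- The last gap of a cluster is followed by a stretch of length `0`.
      refine ⟨[(h, 0)], v + h, ⟨hadj, hadj.2.1, ?_, rfl⟩, hadj.2.1, hs, by simp, ?_, by omega⟩
      · intro b _ h1 h2
        dsimp only at h1 h2
        omega
      · intro e he
        obtain rfl := List.mem_singleton.1 he
        exact ⟨hlen, by dsimp only; omega, hV⟩
    · obtain ⟨b, hbB, h1, h2, hlong', hs'⟩ := exists_first_long hs
      obtain ⟨d, rfl⟩ : ∃ d, b = v + h + d := ⟨b - (v + h), by omega⟩
      have hadm : ∀ l, Admissible q l → Admissible q ((h, d) :: l) := by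
        intro l hl e he
        rcases List.mem_cons.1 he with rfl | he
        · exact ⟨hlen, by dsimp only; omega, by dsimp only; omega⟩
        · exact hl e he
      rcases ih _ hbB hlong' (by omega) with ⟨l, w, h3, h4, h5, h6, h7, h8⟩ | ⟨l, h3, h4, h5⟩
      · left
        exact ⟨(h, d) :: l, w, ⟨hadj, hbB, hs', h3⟩, h4, h5, by simpa using h6, hadm l h7,
          by omega⟩
      · right
        refine ⟨(h, d) :: l, hadm l h3, by simpa using h4, ?_⟩
        intro z hz
        rw [gapSet, Finset.mem_union, Finset.mem_Ioo] at hz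
        rcases hz with hz | hz
        · intro hzB
          dsimp only at hz
          rcases hadj.2.2.2 z hzB with h6 | h6 <;> omega
        · exact h5 z hz

/-! ### The deterministic construction -/

/-- The properties of `A` used in the construction. -/
structure GoodSource (q L W : ℕ) (A : Set ℕ) : Prop where
  dense : DenseBelow q L A
  hits : ∀ x, 1 ≤ x → x < L → ∀ l, Admissible q l → l.length ≤ 14 * q → cost q l ≤ 14 * q →
    ∃ t < W, Fits q A (x + t) l

/-- The properties of `B` used in the construction. -/
structure GoodTarget (q L : ℕ) (B : Set ℕ) : Prop where
  start : ShortGaps q B 0 (2 ^ (18 * q))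
  gap : ∀ b < L, ∃ b' ∈ B, b < b' ∧ b' ≤ b + 800 * q ^ 2
  cost_le : ∀ v < L, ∀ l, Admissible q l → l.length ≤ 14 * q → (∀ z ∈ gapSet v l, z ∉ B) →
    cost q l ≤ 14 * q

/-- The search for the pattern starts half of `v - u` beyond `x` and succeeds within `W`, less than
the other half. So the piece of `A` before the pattern is between half as long and as long as the
stretch from `u` to `v`. -/
theorem exists_segMap_wait {q L W x u v w : ℕ} {A B : Set ℕ} {l : List (ℕ × ℕ)} (hq : 0 < q)
    (hA : GoodSource q L W A) (hW : 2 * W + 2 ≤ 2 ^ (18 * q))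
    (hV : 1000 * q ^ 2 ≤ 2 ^ (18 * q)) (hx : x ∈ A) (hxu : x ≤ 3 * u) (hu : u ∈ B) (hv : v ∈ B)
    (hshort : ShortGaps q B u v) (huv : u + 2 ^ (18 * q) ≤ v) (hl : Admissible q l)
    (hlen : l.length ≤ 14 * q) (hcost : cost q l ≤ 14 * q) (hC : Chain q B v l w)
    (hL : 3 * w ≤ L) :
    ∃ y T, SegMap A B (200 * q) x y u w T ∧ y ≤ 3 * w := by
  have hvw := hC.le
  obtain ⟨t, ht, hF⟩ := hA.hits (x + (v - u + 1) / 2) (by omega) (by omega) l hl hlen hcost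
  obtain ⟨T, hT⟩ := exists_segMap_of_long (x := x) (y := x + (v - u + 1) / 2 + t) (u := u) hq
    hA.dense hx hF.mem hu hv (by omega) (by omega) hshort (by omega) (by omega) (by omega)
  obtain ⟨y, T', hT', hy⟩ := exists_segMap_of_chain hq hA.dense
    (fun e he => ⟨(hl e he).1, (hl e he).2.1⟩) hv hF hC (by omega)
  exact ⟨y, _, hT.trans hT', by omega⟩

/-- A partial map defined far out exists. -/
theorem exists_segMap_far {q L W R : ℕ} {A B : Set ℕ} (hq : 0 < q) (hA : GoodSource q L W A)
    (hB : GoodTarget q L B) (h0A : 0 ∈ A) (h0B : 0 ∈ B) (hW : 2 * W + 2 ≤ 2 ^ (18 * q))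
    (hV : 1000 * q ^ 2 ≤ 2 ^ (18 * q))
    (hL : 3 * (R + 14 * q * (2 ^ (18 * q) + 800 * q ^ 2)) ≤ L) :
    ∃ x u T, SegMap A B (200 * q) 0 x 0 u T ∧ R ≤ u ∧
      u ≤ R + 14 * q * (2 ^ (18 * q) + 800 * q ^ 2) ∧ x ≤ 3 * u := by
  set V := 2 ^ (18 * q) with hVdef
  have hq2 : q ≤ q ^ 2 := Nat.le_self_pow (by norm_num) q
  have hbig : V + 800 * q ^ 2 ≤ 14 * q * (V + 800 * q ^ 2) := Nat.le_mul_of_pos_left _ (by omega)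
  -- Induction on the distance to `R`. Unless `R` has been reached, `u` is followed by a stretch of
  -- length `V` without long gaps.
  have main : ∀ n x u T, R - u ≤ n → SegMap A B (200 * q) 0 x 0 u T → x ≤ 3 * u →
      u ≤ R + 14 * q * (V + 800 * q ^ 2) → R ≤ u ∨ ShortGaps q B u (u + V) → 
      ∃ x u T, SegMap A B (200 * q) 0 x 0 u T ∧ R ≤ u ∧
      u ≤ R + 14 * q * (V + 800 * q ^ 2) ∧ x ≤ 3 * u := by
    intro n
    induction n with
    | zero => intro x u T h1 h2 h3 h4 _; exact ⟨x, u, T, h2, by omega, h4, h3⟩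
    | succ n ih =>
      intro x u T h1 h2 h3 h4 h5
      rcases le_or_gt R u with hRu | hRu
      · exact ⟨x, u, T, h2, hRu, h4, h3⟩
      have hs : ShortGaps q B u (u + V) := h5.resolve_left (by omega)
      have hu : u ∈ B := h2.map_right ▸ h2.maps x h2.right_mem h2.left_le le_rfl
      by_cases hR : ShortGaps q B u R
      · have hst : ShortGaps q B u (max R (u + V)) := by
          rcases max_choice R (u + V) with h | h <;> rw [h] <;> assumption
        -- No long gap starts before `R`: one last stretch, up to the first point `v` of `B` at or
        -- beyond `max R (u + V)`, with an empty cluster.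
        obtain ⟨b, hb, h6, h7, h8⟩ := exists_greatest_mem (u := u) (t := max R (u + V) - 1) hu
          (by omega)
        obtain ⟨b', hb', h9, h10⟩ := hst b hb h6 (by omega)
        have h11 : max R (u + V) ≤ b' := by
          by_contra hcon
          have := h8 b' hb' (by omega)
          omega
        obtain ⟨v, hadj, hvb⟩ := exists_next hb hb' h9
        have h12 : max R (u + V) ≤ v := by
          by_contra hcon
          have := h8 v hadj.2.1 (by omega)
          have := hadj.2.2.1
          omega
        have hsv : ShortGaps q B u v := by
          intro z hz h13 h14
          rcases hadj.2.2.2 z hz with h15 | h15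
          · exact hst z hz h13 (by omega)
          · omega
        obtain ⟨y, T', hT', hy⟩ := exists_segMap_wait (l := []) (w := v) hq hA hW hV h2.right_mem h3
          hu hadj.2.1 hsv (by omega) (by simp [Admissible]) (by simp)
          (by simp only [cost]; omega) rfl (by omega)
        exact ⟨y, v, _, h2.trans hT', by omega, by omega, hy⟩
      · obtain ⟨v, hvB, h6, h7, hlong, hsv⟩ := exists_first_long hR
        have huv : u + V ≤ v := by
          by_contra hcon
          exact hlong (hs v hvB h6 (by omega))
        rcases exists_chain_or hB.gap (14 * q) v hvB hlong
          (by rw [← hVdef]; omega) with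
          ⟨l, w, h8, h9, h10, h11, h12, h13⟩ | ⟨l, h8, h9, h10⟩
        · rw [← hVdef] at h13
          have hvw := h8.le
          obtain ⟨y, T', hT', hy⟩ := exists_segMap_wait hq hA hW hV h2.right_mem h3 hu hvB hsv huv
            h12 h11 (hB.cost_le v (by omega) l h12 h11 h8.notMem) h8 (by omega)
          exact ih y w _ (by omega) (h2.trans hT') hy (by omega) (Or.inr h10)
        -- A cluster of `14 q` gaps has cost above `14 q`, which `GoodTarget` forbids.
        · have h11 := hB.cost_le v (by omega) l h8 h9.le h10
          have h12 := length_le_cost q l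
          omega
  exact main R 0 0 _ (by omega) (SegMap.refl _ h0A h0B) (by omega) (by omega)
    (Or.inr (by rw [Nat.zero_add]; exact hB.start))

/-! ### Events depending on finitely many integers -/

/-- The truth of `Φ a` depends only on `a ∩ S`. -/
def DepOn (S : Finset ℕ) (Φ : Set ℕ → Prop) : Prop :=
  ∀ a b : Set ℕ, (∀ i ∈ S, i ∈ a ↔ i ∈ b) → (Φ a ↔ Φ b)

theorem DepOn.mono {S S' : Finset ℕ} {Φ : Set ℕ → Prop} (h : DepOn S Φ) (hS : S ⊆ S') :
    DepOn S' Φ := fun a b hab => h a b fun i hi => hab i (hS hi)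

theorem DepOn.not {S : Finset ℕ} {Φ : Set ℕ → Prop} (h : DepOn S Φ) :
    DepOn S (fun a => ¬ Φ a) := fun a b hab => not_congr (h a b hab)

theorem DepOn.and {S : Finset ℕ} {Φ Ψ : Set ℕ → Prop} (h : DepOn S Φ) (h' : DepOn S Ψ) :
    DepOn S (fun a => Φ a ∧ Ψ a) := fun a b hab => and_congr (h a b hab) (h' a b hab)

namespace IsRootedBernoulliPercolation

variable {Ω : Type*} [MeasurableSpace Ω] {μ : Measure Ω} {A : Ω → Set ℕ}

theorem measurableSet_mem (hA : IsRootedBernoulliPercolation A μ) (k : ℕ) :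
    MeasurableSet {ω | k ∈ A ω} :=
  measurableSet_setOfPred.2 ((measurable_set_mem k).comp hA.measurable)

theorem measurableSet_cylinder (hA : IsRootedBernoulliPercolation A μ) (S O : Finset ℕ) :
    MeasurableSet {ω | ∀ i ∈ S, (i ∈ A ω ↔ i ∈ O)} := by
  have : {ω | ∀ i ∈ S, (i ∈ A ω ↔ i ∈ O)} = ⋂ i ∈ S, {ω | i ∈ A ω ↔ i ∈ O} := by
    ext ω; simp
  rw [this]
  refine Finset.measurableSet_biInter _ fun i _ => ?_
  by_cases hi : i ∈ O
  · simpa [hi] using hA.measurableSet_mem i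
  · simp only [hi, iff_false]
    exact (hA.measurableSet_mem i).compl

theorem setOf_eq_biUnion {Ω : Type*} {S : Finset ℕ} {Φ : Set ℕ → Prop}
    [DecidablePred fun O : Finset ℕ => Φ ↑O] (hΦ : DepOn S Φ) (A : Ω → Set ℕ) :
    {ω | Φ (A ω)} = ⋃ O ∈ S.powerset.filter (fun O : Finset ℕ => Φ ↑O),
      {ω | ∀ i ∈ S, (i ∈ A ω ↔ i ∈ O)} := by
  classical
  ext ω
  simp only [Set.mem_ofPred_eq, Set.mem_iUnion, Finset.mem_filter, Finset.mem_powerset, exists_prop]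
  constructor
  · intro h
    refine ⟨S.filter (· ∈ A ω), ⟨Finset.filter_subset _ _, (hΦ _ _ ?_).1 h⟩, ?_⟩
    · intro i hi; simp [hi]
    · intro i hi; simp [hi]
  · rintro ⟨O, ⟨_, hO⟩, h⟩
    exact (hΦ _ _ fun i hi => by simpa using h i hi).2 hO

theorem measurableSet_of_depOn (hA : IsRootedBernoulliPercolation A μ) {S : Finset ℕ}
    {Φ : Set ℕ → Prop} (hΦ : DepOn S Φ) : MeasurableSet {ω | Φ (A ω)} := by
  classical
  rw [setOf_eq_biUnion hΦ A]
  exact Finset.measurableSet_biUnion _ fun O _ => hA.measurableSet_cylinder S O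

variable [IsProbabilityMeasure μ]

theorem prob_cylinder (hA : IsRootedBernoulliPercolation A μ) {S : Finset ℕ} (h0 : 0 ∉ S)
    (O : Finset ℕ) : μ.real {ω | ∀ i ∈ S, (i ∈ A ω ↔ i ∈ O)} = (1 / 2) ^ S.card := by
  let f : ℕ → Set Ω := fun k => {ω | k + 1 ∈ A ω ↔ k + 1 ∈ O}
  have hcases : ∀ k, f k = {ω | k + 1 ∈ A ω} ∨ f k = {ω | k + 1 ∈ A ω}ᶜ := by
    intro k
    by_cases hk : k + 1 ∈ O
    · left; simp [f, hk]
    · right; ext ω; simp [f, hk]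
  have hf : ∀ k, μ (f k) = 1 / 2 := by
    intro k
    rcases hcases k with h | h
    · rw [h]; exact hA.prob_mem (k + 1) (by omega)
    · rw [h, prob_compl_eq_one_sub (hA.measurableSet_mem _), hA.prob_mem (k + 1) (by omega)]
      simp
  have hinj : Set.InjOn Nat.pred S := by
    intro a ha b hb hab
    have h1 : a ≠ 0 := fun h => h0 (h ▸ ha)
    have h2 : b ≠ 0 := fun h => h0 (h ▸ hb)
    simp only [Nat.pred_eq_sub_one] at hab
    omega
  have hset : {ω | ∀ i ∈ S, (i ∈ A ω ↔ i ∈ O)} = ⋂ k ∈ S.image Nat.pred, f k := by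
    ext ω
    simp only [Set.mem_ofPred_eq, Set.mem_iInter, Finset.mem_image, f]
    constructor
    · rintro h k ⟨i, hi, rfl⟩
      have h1 : i ≠ 0 := fun h => h0 (h ▸ hi)
      have := h i hi
      rwa [Nat.pred_eq_sub_one, Nat.sub_add_cancel (by omega)]
    · intro h i hi
      have h1 : i ≠ 0 := fun h => h0 (h ▸ hi)
      have := h i.pred ⟨i, hi, rfl⟩
      rwa [Nat.pred_eq_sub_one, Nat.sub_add_cancel (by omega)] at this
  have hind : iIndep (fun k : ℕ => MeasurableSpace.generateFrom {{ω | k + 1 ∈ A ω}}) μ := hA.indep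
  have hmeas : ∀ k ∈ S.image Nat.pred,
      MeasurableSet[MeasurableSpace.generateFrom {{ω | k + 1 ∈ A ω}}] (f k) := by
    intro k _
    have hm : MeasurableSet[MeasurableSpace.generateFrom {{ω | k + 1 ∈ A ω}}]
        {ω | k + 1 ∈ A ω} := MeasurableSpace.measurableSet_generateFrom rfl
    rcases hcases k with h | h
    · rw [h]; exact hm
    · rw [h]; exact hm.compl
  rw [hset, measureReal_def, hind.meas_biInter hmeas, Finset.prod_congr rfl fun k _ => hf k,
    Finset.prod_const, Finset.card_image_of_injOn hinj]
  simp

/-- The cylinders over the subsets of `S` are disjoint and equally likely. Independence and tail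
bounds thus become counting statements. The point `0`, being deterministic, has to be kept out of
`S`. -/
theorem prob_eq_card (hA : IsRootedBernoulliPercolation A μ) {S : Finset ℕ} (h0 : 0 ∉ S)
    {Φ : Set ℕ → Prop} [DecidablePred fun O : Finset ℕ => Φ ↑O] (hΦ : DepOn S Φ) : μ.real {ω | Φ (A ω)} =
      (S.powerset.filter (fun O : Finset ℕ => Φ ↑O)).card * (1 / 2) ^ S.card := by
  rw [setOf_eq_biUnion hΦ A, measureReal_biUnion_finset]
  · rw [Finset.sum_congr rfl fun O _ => hA.prob_cylinder h0 O, Finset.sum_const, nsmul_eq_mul]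
  · intro O hO O' hO' hne
    refine Set.disjoint_left.2 fun ω h h' => hne ?_
    have h1 := Finset.mem_powerset.1 (Finset.mem_filter.1 hO).1
    have h2 := Finset.mem_powerset.1 (Finset.mem_filter.1 hO').1
    ext i
    constructor
    · intro hi; exact (h' i (h1 hi)).1 ((h i (h1 hi)).2 hi)
    · intro hi; exact (h i (h2 hi)).1 ((h' i (h2 hi)).2 hi)
  · intro O _; exact hA.measurableSet_cylinder S O

theorem prob_not (hA : IsRootedBernoulliPercolation A μ) {S : Finset ℕ} {Φ : Set ℕ → Prop}
    (hΦ : DepOn S Φ) : μ.real {ω | ¬ Φ (A ω)} = 1 - μ.real {ω | Φ (A ω)} :=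
  probReal_compl_eq_one_sub (hA.measurableSet_of_depOn hΦ)

/-- Restriction to `S` and `S'` is a bijection from the admissible subsets of `S ∪ S'` to pairs of
admissible subsets. -/
theorem prob_and (hA : IsRootedBernoulliPercolation A μ) {S S' : Finset ℕ} (h0 : 0 ∉ S)
    (h0' : 0 ∉ S') (hS : Disjoint S S') {Φ Ψ : Set ℕ → Prop} (hΦ : DepOn S Φ) (hΨ : DepOn S' Ψ) :
    μ.real {ω | Φ (A ω) ∧ Ψ (A ω)} = μ.real {ω | Φ (A ω)} * μ.real {ω | Ψ (A ω)} := by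
  classical
  have hdep : DepOn (S ∪ S') (fun a => Φ a ∧ Ψ a) :=
    (hΦ.mono Finset.subset_union_left).and (hΨ.mono Finset.subset_union_right)
  rw [hA.prob_eq_card (by simp [h0, h0']) hdep, hA.prob_eq_card h0 hΦ, hA.prob_eq_card h0' hΨ,
    Finset.card_union_of_disjoint hS, pow_add, mul_mul_mul_comm, ← Nat.cast_mul,
    ← Finset.card_product]
  congr 2
  have hd : ∀ i, i ∈ S → i ∉ S' := fun i h h' => Finset.disjoint_left.1 hS h h'
  refine Finset.card_nbij' (fun O => (O ∩ S, O ∩ S')) (fun p => p.1 ∪ p.2) ?_ ?_ ?_ ?_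
  · intro O hO
    simp only [Finset.coe_filter, Finset.mem_powerset, Set.mem_ofPred_eq] at hO
    simp only [Finset.coe_product, Set.mem_prod, Finset.coe_filter, Finset.mem_powerset,
      Set.mem_ofPred_eq]
    refine ⟨⟨Finset.inter_subset_right, (hΦ _ _ ?_).1 hO.2.1⟩,
      ⟨Finset.inter_subset_right, (hΨ _ _ ?_).1 hO.2.2⟩⟩ <;>
    · intro i hi; simp [hi]
  · rintro ⟨O, O'⟩ hO
    simp only [Finset.coe_product, Set.mem_prod, Finset.coe_filter, Finset.mem_powerset,
      Set.mem_ofPred_eq] at hO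
    simp only [Finset.coe_filter, Finset.mem_powerset, Set.mem_ofPred_eq]
    refine ⟨Finset.union_subset_union hO.1.1 hO.2.1, (hΦ _ _ ?_).1 hO.1.2, (hΨ _ _ ?_).1 hO.2.2⟩
    · intro i hi
      have : i ∉ O' := fun h => hd i hi (hO.2.1 h)
      simp [this]
    · intro i hi
      have : i ∉ O := fun h => hd i (hO.1.1 h) hi
      simp [this]
  · intro O hO
    simp only [Finset.coe_filter, Finset.mem_powerset, Set.mem_ofPred_eq] at hO
    dsimp only
    rw [← Finset.inter_union_distrib_left, Finset.inter_eq_left.2 hO.1]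
  · rintro ⟨O, O'⟩ hO
    simp only [Finset.coe_product, Set.mem_prod, Finset.coe_filter, Finset.mem_powerset,
      Set.mem_ofPred_eq] at hO
    refine Prod.ext ?_ ?_
    · ext i
      simp only [Finset.mem_inter, Finset.mem_union]
      have := hd i
      have := @hO.1.1 i
      have := @hO.2.1 i
      tauto
    · ext i
      simp only [Finset.mem_inter, Finset.mem_union]
      have := hd i
      have := @hO.1.1 i
      have := @hO.2.1 i
      tauto

theorem prob_forall (hA : IsRootedBernoulliPercolation A μ) {ι : Type*} (s : Finset ι)
    (S : ι → Finset ℕ) (Φ : ι → Set ℕ → Prop) (h0 : ∀ t ∈ s, 0 ∉ S t)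
    (hd : ∀ t ∈ s, ∀ t' ∈ s, t ≠ t' → Disjoint (S t) (S t')) (hΦ : ∀ t, DepOn (S t) (Φ t)) :
    μ.real {ω | ∀ t ∈ s, Φ t (A ω)} = ∏ t ∈ s, μ.real {ω | Φ t (A ω)} := by
  classical
  induction s using Finset.induction_on with
  | empty => simp
  | insert t s ht ih =>
    have hdep : DepOn (s.biUnion S) (fun a => ∀ t ∈ s, Φ t a) := by
      intro a b hab
      refine forall₂_congr fun t ht => hΦ t a b fun i hi => hab i ?_
      exact Finset.mem_biUnion.2 ⟨t, ht, hi⟩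
    rw [Finset.prod_insert ht, ← ih (fun t ht => h0 t (Finset.mem_insert_of_mem ht))
      (fun t ht t' ht' => hd t (Finset.mem_insert_of_mem ht) t' (Finset.mem_insert_of_mem ht')),
      ← hA.prob_and (h0 t (Finset.mem_insert_self _ _)) ?_ ?_ (hΦ t) hdep]
    · congr 1
      ext ω
      simp
    · simp only [Finset.mem_biUnion, not_exists, not_and]
      exact fun t ht => h0 t (Finset.mem_insert_of_mem ht)
    · rw [Finset.disjoint_biUnion_right]
      intro t' ht'
      exact hd t (Finset.mem_insert_self _ _) t' (Finset.mem_insert_of_mem ht')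
        (fun h => ht (h ▸ ht'))

theorem prob_forall_notMem (hA : IsRootedBernoulliPercolation A μ) {S : Finset ℕ} (h0 : 0 ∉ S) :
    μ.real {ω | ∀ i ∈ S, i ∉ A ω} = (1 / 2) ^ S.card := by
  rw [← hA.prob_cylinder h0 ∅]
  simp

end IsRootedBernoulliPercolation

theorem depOn_countIn (S : Finset ℕ) (P : ℕ → Prop) : DepOn S (fun a => P (countIn a S)) := by
  classical
  intro a b hab
  have : countIn a S = countIn b S := by
    unfold countIn
    rw [Finset.filter_congr hab]
  simp only [this]

theorem countIn_coe {S O : Finset ℕ} (h : O ⊆ S) : countIn (↑O) S = O.card := by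
  classical
  unfold countIn
  congr 1
  ext i
  simp only [Finset.mem_filter, Finset.mem_coe]
  exact ⟨fun hi => hi.2, fun hi => ⟨h hi, hi⟩⟩

namespace IsRootedBernoulliPercolation

variable {Ω : Type*} [MeasurableSpace Ω] {μ : Measure Ω} [IsProbabilityMeasure μ] {A : Ω → Set ℕ}

/-- Complementation in `S` maps the subsets with fewer than `c` points injectively to subsets with
more than `c`. -/
theorem half_le_prob_countIn (hA : IsRootedBernoulliPercolation A μ) {S : Finset ℕ} (h0 : 0 ∉ S)
    {c : ℕ} (hc : S.card = 2 * c) : 1 / 2 ≤ μ.real {ω | c ≤ countIn (A ω) S} := by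
  classical
  rw [hA.prob_eq_card h0 (depOn_countIn S (fun k => c ≤ k))]
  have h1 : (S.powerset.filter (fun O : Finset ℕ => ¬ c ≤ countIn (↑O) S)).card ≤
      (S.powerset.filter (fun O : Finset ℕ => c ≤ countIn (↑O) S)).card := by
    refine Finset.card_le_card_of_injOn (fun O => S \ O) ?_ ?_
    · intro O hO
      simp only [Finset.coe_filter, Finset.mem_powerset, Set.mem_ofPred_eq] at hO ⊢
      rw [countIn_coe hO.1] at hO
      rw [countIn_coe Finset.sdiff_subset, Finset.card_sdiff_of_subset hO.1]
      exact ⟨Finset.sdiff_subset, by omega⟩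
    · intro O hO O' hO' h
      simp only [Finset.coe_filter, Finset.mem_powerset, Set.mem_ofPred_eq] at hO hO'
      dsimp only at h
      rw [← Finset.sdiff_sdiff_eq_self hO.1, h, Finset.sdiff_sdiff_eq_self hO'.1]
  have h2 := Finset.card_filter_add_card_filter_not (s := S.powerset)
    (fun O : Finset ℕ => c ≤ countIn (↑O) S)
  rw [Finset.card_powerset] at h2
  have h3 : (2 : ℝ) ^ S.card ≤
      2 * (S.powerset.filter (fun O : Finset ℕ => c ≤ countIn (↑O) S)).card := by
    have : 2 ^ S.card ≤
      2 * (S.powerset.filter (fun O : Finset ℕ => c ≤ countIn (↑O) S)).card := by omega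
    exact_mod_cast this
  rw [one_div_pow, mul_one_div, div_le_div_iff₀ (by norm_num) (by positivity)]
  linarith

theorem prob_countIn_lt (hA : IsRootedBernoulliPercolation A μ) {S : Finset ℕ} (h0 : 0 ∉ S)
    (k : ℕ) : μ.real {ω | countIn (A ω) S < k} ≤ (S.card + 1) ^ k * (1 / 2) ^ S.card := by
  classical
  rw [hA.prob_eq_card h0 (depOn_countIn S (fun j => j < k))]
  have h1 : (S.powerset.filter (fun O : Finset ℕ => countIn (↑O) S < k)).card ≤
      (S.card + 1) ^ k := by
    have hsub : S.powerset.filter (fun O : Finset ℕ => countIn (↑O) S < k) ⊆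
        (Finset.range k).biUnion fun j => Finset.powersetCard j S := by
      intro O hO
      simp only [Finset.mem_filter, Finset.mem_powerset] at hO
      rw [countIn_coe hO.1] at hO
      simp only [Finset.mem_biUnion, Finset.mem_range, Finset.mem_powersetCard]
      exact ⟨_, hO.2, hO.1, rfl⟩
    calc _ ≤ _ := Finset.card_le_card hsub
      _ ≤ ∑ j ∈ Finset.range k, (Finset.powersetCard j S).card := Finset.card_biUnion_le
      _ ≤ ∑ j ∈ Finset.range k, S.card ^ j := by
          refine Finset.sum_le_sum fun j _ => ?_
          rw [Finset.card_powersetCard]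
          exact Nat.choose_le_pow _ _
      _ ≤ (S.card + 1) ^ k := by
          clear hsub
          generalize S.card = m
          rcases Nat.eq_zero_or_pos m with rfl | hm
          · cases k with
            | zero => simp
            | succ k => rw [Finset.sum_range_succ']; simp
          · induction k with
            | zero => simp
            | succ k ih =>
              rw [Finset.sum_range_succ, pow_succ, Nat.mul_succ]
              have : m ^ k ≤ (m + 1) ^ k * m :=
                (Nat.pow_le_pow_left (Nat.le_succ m) k).trans (Nat.le_mul_of_pos_right _ hm)
              omega
  gcongr
  exact_mod_cast h1

end IsRootedBernoulliPercolation

/-! ### The probability of a pattern -/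

/-- The length of the part of a stretch on which the pattern imposes a condition. -/
def headLen (q d : ℕ) : ℕ :=
  if d = 0 then 0 else if d ≤ 1000 * q ^ 2 then 2 * coverCount q d + 1 else 1

theorem headLen_le_spacing (q d : ℕ) : headLen q d ≤ spacing q d := by
  unfold headLen spacing
  split_ifs <;> omega

theorem headLen_le {q : ℕ} (hq : 0 < q) (d : ℕ) : headLen q d ≤ 101 * q := by
  unfold headLen
  split_ifs with h1 h2
  · omega
  · have h3 := (ceil_div_bounds (m := 20 * q) (by omega) d).2
    have h4 : coverCount q d ≤ 50 * q := by
      have h5 : 20 * q * coverCount q d < 20 * q * (50 * q + 1) := by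
        have : 20 * q * (50 * q + 1) = 1000 * q ^ 2 + 20 * q := by ring
        unfold coverCount
        omega
      exact Nat.lt_succ_iff.1 (Nat.lt_of_mul_lt_mul_left h5)
    omega
  · omega

/-- The integers on which the occurrence of a pattern at `y` depends. -/
def patternSupport (q : ℕ) : ℕ → List (ℕ × ℕ) → Finset ℕ
  | y, [] => {y}
  | y, e :: l => Finset.Ico y (y + gapLen q e.1 + headLen q e.2) ∪
      patternSupport q (y + gapLen q e.1 + spacing q e.2) l

theorem le_of_mem_patternSupport {q : ℕ} {l : List (ℕ × ℕ)} :
    ∀ {y z : ℕ}, z ∈ patternSupport q y l → y ≤ z := by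
  induction l with
  | nil => intro y z h; exact (Finset.mem_singleton.1 h).ge
  | cons e l ih =>
    intro y z h
    rw [patternSupport, Finset.mem_union, Finset.mem_Ico] at h
    rcases h with h | h
    · exact h.1
    · have := ih h
      omega

theorem mem_patternSupport_add {q : ℕ} {l : List (ℕ × ℕ)} :
    ∀ {y z t : ℕ}, z ∈ patternSupport q (y + t) l ↔ ∃ z' ∈ patternSupport q y l, z' + t = z := by
  induction l with
  | nil =>
    intro y z t
    simp [patternSupport, eq_comm]
  | cons e l ih =>
    intro y z t
    simp only [patternSupport, Finset.mem_union, Finset.mem_Ico]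
    rw [show y + t + gapLen q e.1 + spacing q e.2 = y + gapLen q e.1 + spacing q e.2 + t by ring, ih]
    constructor
    · rintro (h | ⟨z', h, h'⟩)
      · exact ⟨z - t, Or.inl (by omega), by omega⟩
      · exact ⟨z', Or.inr h, h'⟩
    · rintro ⟨z', h | h, h'⟩
      · left; omega
      · exact Or.inr ⟨z', h, h'⟩

/-- A long stretch contributes a single integer, so the support is polynomial in `q` although the
pattern may extend over exponentially many integers. Hence many disjoint translates fit into a short
window. -/
theorem card_patternSupport_le {q : ℕ} (hq : 0 < q) {l : List (ℕ × ℕ)} :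
    ∀ y, (patternSupport q y l).card ≤ cost q l + 101 * q * l.length := by
  induction l with
  | nil => intro y; simp [patternSupport, cost]
  | cons e l ih =>
    intro y
    have h1 := ih (y + gapLen q e.1 + spacing q e.2)
    have h2 := headLen_le hq e.2
    have h3 := Finset.card_union_le (Finset.Ico y (y + gapLen q e.1 + headLen q e.2))
      (patternSupport q (y + gapLen q e.1 + spacing q e.2) l)
    rw [Nat.card_Ico] at h3
    simp only [patternSupport, cost, List.length_cons, Nat.mul_succ]
    omega

/-- The part of `HeadFits` that concerns the gap. -/
theorem depOn_headGap (q y h d : ℕ) (ha : 0 < gapLen q h) :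
    DepOn (Finset.Ico y (y + gapLen q h + min d 1)) (fun A => y ∈ A ∧
      (∀ z, y < z → z < y + gapLen q h → z ∉ A) ∧ (0 < d → y + gapLen q h ∈ A)) := by
  intro a b hab
  simp only [Finset.mem_Ico] at hab
  refine and_congr (hab y (by omega)) (and_congr ?_ ?_)
  · refine forall_congr' fun z => forall₂_congr fun h1 h2 => not_congr (hab z (by omega))
  · refine forall_congr' fun h1 => hab _ (by omega)

theorem depOn_headCount (q y d : ℕ) :
    DepOn (Finset.Ico (y + min d 1) (y + headLen q d)) (fun A => 0 < d → d ≤ 1000 * q ^ 2 →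
      coverCount q d ≤ countIn A (Finset.Ioo y (y + (2 * coverCount q d + 1)))) := by
  intro a b hab
  refine forall₂_congr fun h1 h2 => ?_
  refine (depOn_countIn _ (fun k => coverCount q d ≤ k)).mono ?_ a b hab
  unfold headLen
  rw [if_neg (by omega), if_pos h2]
  intro z
  simp only [Finset.mem_Ioo, Finset.mem_Ico]
  omega

theorem min_one_le_headLen (q d : ℕ) : min d 1 ≤ headLen q d := by
  unfold headLen
  split_ifs <;> omega

theorem depOn_headFits (q y h d : ℕ) (ha : 0 < gapLen q h) :
    DepOn (Finset.Ico y (y + gapLen q h + headLen q d)) (fun A => HeadFits q A y h d) := by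
  have := min_one_le_headLen q d
  exact ((depOn_headGap q y h d ha).mono (Finset.Ico_subset_Ico_right (by omega))).and
    ((depOn_headCount q (y + gapLen q h) d).mono (Finset.Ico_subset_Ico_left (by omega)))

theorem depOn_fits {q : ℕ} {l : List (ℕ × ℕ)} :
    ∀ y, (∀ e ∈ l, 0 < gapLen q e.1) → DepOn (patternSupport q y l) (fun A => Fits q A y l) := by
  induction l with
  | nil =>
    intro y _ a b hab
    exact hab y (by simp [patternSupport])
  | cons e l ih =>
    intro y hl
    exact ((depOn_headFits q y e.1 e.2 (hl e List.mem_cons_self)).mono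
      Finset.subset_union_left).and ((ih _ fun e he => hl e (List.mem_cons_of_mem _ he)).mono
      Finset.subset_union_right)

/-- Many translates of a finite set by small amounts are pairwise disjoint. -/
theorem exists_disjoint_translates (P : Finset ℕ) (r : ℕ) :
    ∃ s : Finset ℕ, s.card = r ∧ (∀ t ∈ s, t < r * (P.card ^ 2 + 1)) ∧
      ∀ t ∈ s, ∀ t' ∈ s, t ≠ t' → ∀ a ∈ P, ∀ b ∈ P, a + t ≠ b + t' := by
  classical
  induction r with
  | zero => exact ⟨∅, by simp⟩
  | succ r ih =>
    obtain ⟨s, hs, hlt, hdis⟩ := ih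
    -- Each translate already chosen excludes itself and at most `P.card ^ 2` further values.
    -- Truncated subtraction only adds superfluous exclusions.
    let F : Finset ℕ := (s ×ˢ (P ×ˢ P)).image (fun p => p.1 + p.2.1 - p.2.2) ∪ s
    have hF : F.card ≤ r * (P.card ^ 2 + 1) := by
      calc F.card ≤ (s ×ˢ (P ×ˢ P)).card + s.card :=
            (Finset.card_union_le _ _).trans (Nat.add_le_add_right Finset.card_image_le _)
        _ = r * (P.card ^ 2 + 1) := by rw [Finset.card_product, Finset.card_product, hs]; ring
    obtain ⟨t, ht, htF⟩ : ∃ t ∈ Finset.range (r * (P.card ^ 2 + 1) + 1), t ∉ F :=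
      Finset.exists_mem_notMem_of_card_lt_card (by rw [Finset.card_range]; omega)
    rw [Finset.mem_range] at ht
    have hts : t ∉ s := fun h => htF (Finset.mem_union_right _ h)
    have key : ∀ t' ∈ s, ∀ a ∈ P, ∀ b ∈ P, a + t ≠ b + t' := by
      intro t' ht' a ha b hb heq
      refine htF (Finset.mem_union_left _ (Finset.mem_image.2 ⟨(t', b, a), ?_, ?_⟩))
      · simp [ht', ha, hb]
      · dsimp only; omega
    refine ⟨insert t s, by rw [Finset.card_insert_of_notMem hts, hs], ?_, ?_⟩
    · intro t' ht'
      rw [Nat.succ_mul]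
      rcases Finset.mem_insert.1 ht' with rfl | h
      · omega
      · have := hlt t' h; omega
    · intro t₁ h₁ t₂ h₂ hne a ha b hb
      rcases Finset.mem_insert.1 h₁ with rfl | h₁'
      · rcases Finset.mem_insert.1 h₂ with rfl | h₂
        · exact absurd rfl hne
        · exact key t₂ h₂ a ha b hb
      · rcases Finset.mem_insert.1 h₂ with rfl | h₂
        · exact fun h => key t₁ h₁' b hb a ha h.symm
        · exact hdis t₁ h₁' t₂ h₂ hne a ha b hb

namespace IsRootedBernoulliPercolation

variable {Ω : Type*} [MeasurableSpace Ω] {μ : Measure Ω} [IsProbabilityMeasure μ] {A : Ω → Set ℕ}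

theorem le_prob_headGap (hA : IsRootedBernoulliPercolation A μ) {q y h : ℕ} (d : ℕ) (hy : 1 ≤ y)
    (ha : 0 < gapLen q h) :
    (1 / 2) ^ (gapLen q h + 1) ≤ μ.real {ω | y ∈ A ω ∧
      (∀ z, y < z → z < y + gapLen q h → z ∉ A ω) ∧ (0 < d → y + gapLen q h ∈ A ω)} := by
  set a := gapLen q h with hadef
  -- The cylinder prescribes the point `y + a` even for `d = 0`; this gives one bound for all `d`.
  have h1 := hA.prob_cylinder (S := Finset.Ico y (y + a + 1))
    (by simp only [Finset.mem_Ico]; omega) {y, y + a}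
  rw [Nat.card_Ico, show y + a + 1 - y = a + 1 by omega] at h1
  rw [← h1]
  refine measureReal_mono fun ω hω => ?_
  simp only [Set.mem_ofPred_eq, Finset.mem_Ico, Finset.mem_insert, Finset.mem_singleton] at hω ⊢
  refine ⟨(hω y (by omega)).2 (Or.inl rfl), fun z h2 h3 hz => ?_, fun _ =>
    (hω (y + a) (by omega)).2 (Or.inr rfl)⟩
  have := (hω z (by omega)).1 hz
  omega

theorem le_prob_headCount (hA : IsRootedBernoulliPercolation A μ) (q y d : ℕ) :
    1 / 2 ≤ μ.real {ω | 0 < d → d ≤ 1000 * q ^ 2 →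
      coverCount q d ≤ countIn (A ω) (Finset.Ioo y (y + (2 * coverCount q d + 1)))} := by
  refine (hA.half_le_prob_countIn (S := Finset.Ioo y (y + (2 * coverCount q d + 1)))
    (c := coverCount q d) (by simp) (by rw [Nat.card_Ioo]; omega)).trans ?_
  exact measureReal_mono fun ω hω _ _ => hω

/-- Gaps and counts concern disjoint sets of integers, so the probabilities multiply: `2 ^ (-(gapLen
+ 1))` for each gap, `1 / 2` for each count and `1 / 2` for the final point. -/
theorem le_prob_fits (hA : IsRootedBernoulliPercolation A μ) {q : ℕ} {l : List (ℕ × ℕ)} :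
    ∀ y, 1 ≤ y → (∀ e ∈ l, 0 < gapLen q e.1) →
      (1 / 2) ^ cost q l ≤ μ.real {ω | Fits q (A ω) y l} := by
  induction l with
  | nil =>
    intro y hy _
    have h1 := hA.prob_cylinder (S := {y}) (by simp; omega) {y}
    simp only [Finset.mem_singleton, forall_eq, iff_true, Finset.card_singleton] at h1
    simp only [cost, Fits]
    exact h1.ge
  | cons e l ih =>
    obtain ⟨h, d⟩ := e
    intro y hy hl
    have ha : 0 < gapLen q h := hl (h, d) List.mem_cons_self
    have hl' : ∀ e ∈ l, 0 < gapLen q e.1 := fun e he => hl e (List.mem_cons_of_mem _ he)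
    have hmin := min_one_le_headLen q d
    have hsp := headLen_le_spacing q d
    have hhead : (1 / 2) ^ (gapLen q h + 2) ≤ μ.real {ω | HeadFits q (A ω) y h d} := by
      rw [pow_succ]
      refine (mul_le_mul (hA.le_prob_headGap d hy ha)
        (hA.le_prob_headCount q (y + gapLen q h) d) (by positivity) measureReal_nonneg).trans ?_
      rw [← hA.prob_and _ _ _ (depOn_headGap q y h d ha) (depOn_headCount q (y + gapLen q h) d)]
      · exact le_rfl
      · simp only [Finset.mem_Ico]; omega
      · simp only [Finset.mem_Ico]; omega
      · rw [Finset.disjoint_left]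
        intro z
        simp only [Finset.mem_Ico]
        omega
    simp only [cost, Fits]
    rw [pow_add, hA.prob_and _ _ _ (depOn_headFits q y h d ha) (depOn_fits _ hl')]
    · exact mul_le_mul hhead (ih _ (by omega) hl') (by positivity) measureReal_nonneg
    · simp only [Finset.mem_Ico]; omega
    · intro h0
      have := le_of_mem_patternSupport h0
      omega
    · rw [Finset.disjoint_left]
      intro z hz hz'
      have := le_of_mem_patternSupport hz'
      simp only [Finset.mem_Ico] at hz
      omega

/-- Translates with disjoint supports are independent trials. -/
theorem prob_forall_not_fits (hA : IsRootedBernoulliPercolation A μ) {q : ℕ} {l : List (ℕ × ℕ)}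
    {x p r W : ℕ} (hx : 1 ≤ x) (hl : ∀ e ∈ l, 0 < gapLen q e.1)
    (hp : (patternSupport q x l).card ≤ p) (hW : r * (p ^ 2 + 1) ≤ W) :
    μ.real {ω | ∀ t < W, ¬ Fits q (A ω) (x + t) l} ≤ (1 - (1 / 2) ^ cost q l) ^ r := by
  obtain ⟨s, hs, hlt, hdis⟩ := exists_disjoint_translates (patternSupport q x l) r
  have hsW : ∀ t ∈ s, t < W := fun t ht => (hlt t ht).trans_le
    ((Nat.mul_le_mul_left r (Nat.add_le_add_right (Nat.pow_le_pow_left hp 2) 1)).trans hW)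
  calc μ.real {ω | ∀ t < W, ¬ Fits q (A ω) (x + t) l}
      ≤ μ.real {ω | ∀ t ∈ s, ¬ Fits q (A ω) (x + t) l} :=
        measureReal_mono fun ω hω t ht => hω t (hsW t ht)
    _ = ∏ t ∈ s, μ.real {ω | ¬ Fits q (A ω) (x + t) l} := by
        refine hA.prob_forall s (fun t => patternSupport q (x + t) l)
          (fun t a => ¬ Fits q a (x + t) l) ?_ ?_ fun t => (depOn_fits _ hl).not
        · intro t _ h0
          have := le_of_mem_patternSupport h0
          omega
        · intro t ht t' ht' hne
          rw [Finset.disjoint_left]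
          intro z hz hz'
          obtain ⟨a, ha, rfl⟩ := mem_patternSupport_add.1 hz
          obtain ⟨b, hb, hab⟩ := mem_patternSupport_add.1 hz'
          exact hdis t ht t' ht' hne a ha b hb hab.symm
    _ ≤ ∏ _t ∈ s, (1 - (1 / 2) ^ cost q l) := by
        refine Finset.prod_le_prod (fun _ _ => measureReal_nonneg) fun t _ => ?_
        rw [hA.prob_not (depOn_fits (x + t) hl)]
        have := hA.le_prob_fits (x + t) (by omega) hl
        linarith
    _ = (1 - (1 / 2) ^ cost q l) ^ r := by rw [Finset.prod_const, hs]

end IsRootedBernoulliPercolation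

/-! ### Union bounds over clusters -/

/-- The lists of length `k` with entries in `D`. -/
def listsOf (D : Finset (ℕ × ℕ)) : ℕ → Finset (List (ℕ × ℕ))
  | 0 => {[]}
  | k + 1 => (D ×ˢ listsOf D k).image (fun p => p.1 :: p.2)

theorem card_listsOf_le (D : Finset (ℕ × ℕ)) (k : ℕ) : (listsOf D k).card ≤ D.card ^ k := by
  induction k with
  | zero => simp [listsOf]
  | succ k ih =>
    refine Finset.card_image_le.trans ?_
    rw [Finset.card_product, pow_succ, mul_comm]
    exact Nat.mul_le_mul_right _ ih

theorem mem_listsOf {D : Finset (ℕ × ℕ)} {l : List (ℕ × ℕ)} (h : ∀ e ∈ l, e ∈ D) :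
    l ∈ listsOf D l.length := by
  induction l with
  | nil => simp [listsOf]
  | cons e l ih =>
    simp only [List.length_cons, listsOf, Finset.mem_image, Finset.mem_product]
    exact ⟨(e, l), ⟨h e List.mem_cons_self, ih fun e he => h e (List.mem_cons_of_mem _ he)⟩, rfl⟩

theorem length_of_mem_listsOf {D : Finset (ℕ × ℕ)} {k : ℕ} :
    ∀ {l : List (ℕ × ℕ)}, l ∈ listsOf D k → l.length = k := by
  induction k with
  | zero => intro l h; simp [Finset.mem_singleton.1 h]
  | succ k ih =>
    intro l h
    simp only [listsOf, Finset.mem_image, Finset.mem_product] at h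
    obtain ⟨p, hp, rfl⟩ := h
    simp [ih hp.2]

/-- The possible entries of admissible lists. -/
def entries (q : ℕ) : Finset (ℕ × ℕ) := Finset.range (800 * q ^ 2 + 1) ×ˢ Finset.range (2 ^ (18 * q))

theorem Admissible.mem_listsOf {q : ℕ} {l : List (ℕ × ℕ)} (h : Admissible q l) :
    l ∈ listsOf (entries q) l.length := by
  refine _root_.mem_listsOf fun e he => ?_
  have := h e he
  rw [entries, Finset.mem_product, Finset.mem_range, Finset.mem_range]
  omega

theorem lt_of_mem_gapSet {l : List (ℕ × ℕ)} : ∀ {v z : ℕ}, z ∈ gapSet v l → v < z := by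
  induction l with
  | nil => intro v z h; simp [gapSet] at h
  | cons e l ih =>
    intro v z h
    rw [gapSet, Finset.mem_union, Finset.mem_Ioo] at h
    rcases h with h | h
    · exact h.1
    · have := ih h
      omega

/-- In the second bound each gap loses `200 q` to rounding up and `400 q` to the summand `2` of its
cost. -/
theorem card_gapSet_ge {q : ℕ} (hq : 0 < q) {l : List (ℕ × ℕ)} : ∀ {v : ℕ}, Admissible q l →
    180 * q * l.length ≤ (gapSet v l).card ∧
      200 * q * cost q l ≤ (gapSet v l).card + 600 * q * l.length + 200 * q := by
  induction l with
  | nil => intro v _; simp [gapSet, cost]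
  | cons e l ih =>
    intro v h
    have h1 := h e List.mem_cons_self
    have h2 := @ih (v + e.1 + e.2) fun e he => h e (List.mem_cons_of_mem _ he)
    have h3 := (ceil_div_bounds (m := 200 * q) (by omega) e.1).2
    have hdisj : Disjoint (Finset.Ioo v (v + e.1)) (gapSet (v + e.1 + e.2) l) := by
      rw [Finset.disjoint_left]
      intro z hz hz'
      have := lt_of_mem_gapSet hz'
      rw [Finset.mem_Ioo] at hz
      omega
    simp only [gapSet, cost, List.length_cons]
    rw [Finset.card_union_of_disjoint hdisj, Nat.card_Ioo, Nat.mul_add (200 * q) (gapLen q e.1 + 2),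
      Nat.mul_add (200 * q) (gapLen q e.1), Nat.mul_succ (180 * q), Nat.mul_succ (600 * q)]
    unfold gapLen
    omega

theorem card_gapSet_ge_of_cost {q v : ℕ} (hq : 0 < q) {l : List (ℕ × ℕ)} (h : Admissible q l)
    (hc : 14 * q < cost q l) : 560 * q ^ 2 + 24 * q * l.length ≤ (gapSet v l).card := by
  obtain ⟨h1, h2⟩ := card_gapSet_ge hq (v := v) h
  have h3 : 200 * q * (14 * q + 1) ≤ 200 * q * cost q l := Nat.mul_le_mul_left _ hc
  have h4 : 200 * q * (14 * q + 1) = 2800 * q ^ 2 + 200 * q := by ring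
  rw [Nat.mul_assoc] at h1 ⊢
  rw [Nat.mul_assoc 600] at h2
  -- One fifth of the second bound plus four fifths of the first: `2800 / 5 = 560` and `(4 * 180 -
  -- 600) / 5 = 24`.
  omega

theorem measureReal_le_card_mul {Ω ι : Type*} [MeasurableSpace Ω] {μ : Measure Ω}
    [IsFiniteMeasure μ] (s : Finset ι) (f : ι → Set Ω) {c : ℝ} {E : Set Ω}
    (h : ∀ i ∈ s, μ.real (f i) ≤ c) (hE : E ⊆ ⋃ i ∈ s, f i) : μ.real E ≤ s.card * c :=
  calc μ.real E ≤ μ.real (⋃ i ∈ s, f i) := measureReal_mono hE (measure_ne_top _ _)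
    _ ≤ ∑ i ∈ s, μ.real (f i) := measureReal_biUnion_finset_le _ _
    _ ≤ s.card * c := by simpa using Finset.sum_le_card_nsmul s _ c h

namespace IsRootedBernoulliPercolation

variable {Ω : Type*} [MeasurableSpace Ω] {μ : Measure Ω} [IsProbabilityMeasure μ] {A : Ω → Set ℕ}

theorem prob_exists_gap (hA : IsRootedBernoulliPercolation A μ) (L g : ℕ) :
    μ.real {ω | ¬ ∀ b < L, ∃ b' ∈ A ω, b < b' ∧ b' ≤ b + g} ≤ L * (1 / 2) ^ g := by
  have := measureReal_le_card_mul (μ := μ) (Finset.range L)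
    (fun b => {ω | ∀ i ∈ Finset.Ioc b (b + g), i ∉ A ω}) (c := (1 / 2) ^ g)
    (E := {ω | ¬ ∀ b < L, ∃ b' ∈ A ω, b < b' ∧ b' ≤ b + g}) ?_ ?_
  · rwa [Finset.card_range] at this
  · intro b _
    rw [hA.prob_forall_notMem (by simp), Nat.card_Ioc, Nat.add_sub_cancel_left]
  · intro ω hω
    simp only [Set.mem_ofPred_eq] at hω
    push Not at hω
    obtain ⟨b, hb, h⟩ := hω
    simp only [Set.mem_iUnion, Finset.mem_range, exists_prop, Set.mem_ofPred_eq, Finset.mem_Ioc]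
    refine ⟨b, hb, fun i hi hiA => ?_⟩
    have := h i hiA hi.1
    omega

theorem prob_not_shortGaps (hA : IsRootedBernoulliPercolation A μ) (q V : ℕ) :
    μ.real {ω | ¬ ShortGaps q (A ω) 0 V} ≤ V * (1 / 2) ^ (180 * q) := by
  have hsub : {ω | ¬ ShortGaps q (A ω) 0 V} ⊆
      {ω | ¬ ∀ b < V, ∃ b' ∈ A ω, b < b' ∧ b' ≤ b + 180 * q} :=
    fun ω hω hcon => hω fun b _ _ hb => hcon b hb
  exact (measureReal_mono hsub).trans (hA.prob_exists_gap V (180 * q))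

theorem prob_not_denseBelow (hA : IsRootedBernoulliPercolation A μ) (q L : ℕ) :
    μ.real {ω | ¬ DenseBelow q L (A ω)} ≤
      L * ((500 * q ^ 2 + 1) ^ (100 * q) * (1 / 2) ^ (500 * q ^ 2)) := by
  have := measureReal_le_card_mul (μ := μ) (Finset.range L)
    (fun x => {ω | countIn (A ω) (Finset.Ioc x (x + 500 * q ^ 2)) < 100 * q})
    (c := (500 * q ^ 2 + 1) ^ (100 * q) * (1 / 2) ^ (500 * q ^ 2))
    (E := {ω | ¬ DenseBelow q L (A ω)}) ?_ ?_
  · rwa [Finset.card_range] at this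
  · intro x _
    have := hA.prob_countIn_lt (S := Finset.Ioc x (x + 500 * q ^ 2)) (by simp) (100 * q)
    rw [Nat.card_Ioc, Nat.add_sub_cancel_left] at this
    exact_mod_cast this
  · intro ω hω
    simp only [Set.mem_ofPred_eq, DenseBelow] at hω
    push Not at hω
    obtain ⟨x, hx, h⟩ := hω
    simp only [Set.mem_iUnion, Finset.mem_range, exists_prop, Set.mem_ofPred_eq]
    exact ⟨x, hx, h⟩

/-- There are at most `2 ^ (24 q k)` clusters of `k` gaps, and each expensive one has probability at
most `2 ^ (-560 q² - 24 q k)`: the number of clusters cancels. -/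
theorem prob_cost_gt (hA : IsRootedBernoulliPercolation A μ) {q : ℕ} (hq : 0 < q) (L : ℕ)
    (hD : (entries q).card ≤ 2 ^ (24 * q)) :
    μ.real {ω | ¬ ∀ v < L, ∀ l, Admissible q l → l.length ≤ 14 * q →
      (∀ z ∈ gapSet v l, z ∉ A ω) → cost q l ≤ 14 * q} ≤
      L * ((14 * q + 1) * (1 / 2) ^ (560 * q ^ 2)) := by
  classical
  let F : ℕ → Finset (List (ℕ × ℕ)) := fun k =>
    (listsOf (entries q) k).filter (fun l => Admissible q l ∧ 14 * q < cost q l)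
  have hbound : ∀ v k, μ.real (⋃ l ∈ F k, {ω | ∀ z ∈ gapSet v l, z ∉ A ω}) ≤
      (1 / 2) ^ (560 * q ^ 2) := by
    intro v k
    refine (measureReal_le_card_mul (F k) _ (c := (1 / 2) ^ (560 * q ^ 2 + 24 * q * k)) ?_
      subset_rfl).trans ?_
    · intro l hl
      obtain ⟨hl1, hl2, hl3⟩ := Finset.mem_filter.1 hl
      rw [hA.prob_forall_notMem fun h0 => absurd (lt_of_mem_gapSet h0) (by omega)]
      refine pow_le_pow_of_le_one (by norm_num) (by norm_num) ?_
      have := card_gapSet_ge_of_cost hq (v := v) hl2 hl3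
      rwa [length_of_mem_listsOf hl1] at this
    · have h1 : (F k).card ≤ 2 ^ (24 * q * k) :=
        (Finset.card_filter_le _ _).trans ((card_listsOf_le _ k).trans
          ((Nat.pow_le_pow_left hD k).trans_eq (by rw [← pow_mul])))
      have h2 : ((F k).card : ℝ) ≤ 2 ^ (24 * q * k) := by exact_mod_cast h1
      calc ((F k).card : ℝ) * (1 / 2) ^ (560 * q ^ 2 + 24 * q * k)
          ≤ 2 ^ (24 * q * k) * (1 / 2) ^ (560 * q ^ 2 + 24 * q * k) := by gcongr
        _ = (1 / 2) ^ (560 * q ^ 2) * (2 * (1 / 2)) ^ (24 * q * k) := by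
            rw [pow_add, mul_pow]; ring
        _ = (1 / 2) ^ (560 * q ^ 2) := by norm_num
  have hbound' : ∀ v, μ.real (⋃ k ∈ Finset.range (14 * q + 1), ⋃ l ∈ F k,
      {ω | ∀ z ∈ gapSet v l, z ∉ A ω}) ≤ (14 * q + 1) * (1 / 2) ^ (560 * q ^ 2) := by
    intro v
    have := measureReal_le_card_mul (μ := μ) (Finset.range (14 * q + 1)) _
      (fun k _ => hbound v k) subset_rfl
    rw [Finset.card_range] at this
    exact_mod_cast this
  have := measureReal_le_card_mul (μ := μ) (Finset.range L) _ (fun v _ => hbound' v)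
    (E := {ω | ¬ ∀ v < L, ∀ l, Admissible q l → l.length ≤ 14 * q →
      (∀ z ∈ gapSet v l, z ∉ A ω) → cost q l ≤ 14 * q}) ?_
  · rwa [Finset.card_range] at this
  · intro ω hω
    simp only [Set.mem_ofPred_eq] at hω
    push Not at hω
    obtain ⟨v, hv, l, hl, hlen, hz, hc⟩ := hω
    simp only [Set.mem_iUnion, Finset.mem_range, exists_prop, Set.mem_ofPred_eq]
    exact ⟨v, hv, l.length, by omega, l, Finset.mem_filter.2 ⟨hl.mem_listsOf, hl, hc⟩, hz⟩

theorem gapLen_pos {q h : ℕ} (hq : 0 < q) (hh : 0 < h) : 0 < gapLen q h := by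
  have h1 := (ceil_div_bounds (m := 200 * q) (by omega) h).1
  rcases Nat.eq_zero_or_pos (gapLen q h) with h0 | h0
  · unfold gapLen at h0
    rw [h0] at h1
    omega
  · exact h0

/-- Union bound over the positions `x`, the lengths and the at most `2 ^ (24 q * 14 q)` lists of
each length. -/
theorem prob_no_hit (hA : IsRootedBernoulliPercolation A μ) {q r W : ℕ} (hq : 0 < q) (L : ℕ)
    (hW : r * ((14 * q + 101 * q * (14 * q)) ^ 2 + 1) ≤ W) (hD : (entries q).card ≤ 2 ^ (24 * q)) :
    μ.real {ω | ¬ ∀ x, 1 ≤ x → x < L → ∀ l, Admissible q l → l.length ≤ 14 * q →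
      cost q l ≤ 14 * q → ∃ t < W, Fits q (A ω) (x + t) l} ≤
      L * ((14 * q + 1) * (2 ^ (24 * q * (14 * q)) * (1 - (1 / 2) ^ (14 * q)) ^ r)) := by
  classical
  let F : ℕ → Finset (List (ℕ × ℕ)) := fun k =>
    (listsOf (entries q) k).filter (fun l => Admissible q l ∧ cost q l ≤ 14 * q)
  have hnn : (0 : ℝ) ≤ 1 - (1 / 2) ^ (14 * q) := by
    have : ((1 : ℝ) / 2) ^ (14 * q) ≤ 1 := pow_le_one₀ (by norm_num) (by norm_num)
    linarith
  have hbound : ∀ x ∈ Finset.Ico 1 L, ∀ k ∈ Finset.range (14 * q + 1),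
      μ.real (⋃ l ∈ F k, {ω | ∀ t < W, ¬ Fits q (A ω) (x + t) l}) ≤
      2 ^ (24 * q * (14 * q)) * (1 - (1 / 2) ^ (14 * q)) ^ r := by
    intro x hx k hk
    rw [Finset.mem_range] at hk
    rw [Finset.mem_Ico] at hx
    refine (measureReal_le_card_mul (F k) _ (c := (1 - (1 / 2) ^ (14 * q)) ^ r) ?_
      subset_rfl).trans ?_
    · intro l hl
      obtain ⟨hl1, hl2, hl3⟩ := Finset.mem_filter.1 hl
      have hlen := length_of_mem_listsOf hl1
      refine (hA.prob_forall_not_fits (l := l) (p := 14 * q + 101 * q * (14 * q)) hx.1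
        (fun e he => gapLen_pos hq (by have := hl2 e he; omega)) ?_ hW).trans ?_
      · refine (card_patternSupport_le hq x).trans ?_
        have : 101 * q * l.length ≤ 101 * q * (14 * q) := Nat.mul_le_mul_left _ (by omega)
        omega
      · have h1 : ((1 : ℝ) / 2) ^ (14 * q) ≤ (1 / 2) ^ cost q l :=
          pow_le_pow_of_le_one (by norm_num) (by norm_num) hl3
        have h2 : ((1 : ℝ) / 2) ^ cost q l ≤ 1 := pow_le_one₀ (by norm_num) (by norm_num)
        exact pow_le_pow_left₀ (by linarith) (by linarith) r
    · have h1 : (F k).card ≤ 2 ^ (24 * q * (14 * q)) :=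
        (Finset.card_filter_le _ _).trans ((card_listsOf_le _ k).trans
          ((Nat.pow_le_pow_left hD k).trans (by
            rw [← pow_mul]
            exact Nat.pow_le_pow_right (by norm_num) (Nat.mul_le_mul_left _ (by omega)))))
      have h2 : ((F k).card : ℝ) ≤ 2 ^ (24 * q * (14 * q)) := by exact_mod_cast h1
      exact mul_le_mul_of_nonneg_right h2 (pow_nonneg hnn r)
  have hbound' : ∀ x ∈ Finset.Ico 1 L, μ.real (⋃ k ∈ Finset.range (14 * q + 1), ⋃ l ∈ F k,
      {ω | ∀ t < W, ¬ Fits q (A ω) (x + t) l}) ≤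
      (14 * q + 1) * (2 ^ (24 * q * (14 * q)) * (1 - (1 / 2) ^ (14 * q)) ^ r) := by
    intro x hx
    have := measureReal_le_card_mul (μ := μ) (Finset.range (14 * q + 1)) _ (hbound x hx) subset_rfl
    rw [Finset.card_range] at this
    exact_mod_cast this
  refine (measureReal_le_card_mul (μ := μ) (Finset.Ico 1 L) _ hbound' ?_).trans ?_
  · intro ω hω
    simp only [Set.mem_ofPred_eq] at hω
    push Not at hω
    obtain ⟨x, hx1, hx, l, hl, hlen, hc, hF⟩ := hω
    simp only [Set.mem_iUnion, Finset.mem_range, exists_prop, Set.mem_ofPred_eq, Finset.mem_Ico]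
    exact ⟨x, ⟨hx1, hx⟩, l.length, by omega, l, Finset.mem_filter.2 ⟨hl.mem_listsOf, hl, hc⟩, hF⟩
  · have : ((Finset.Ico 1 L).card : ℝ) ≤ L := by
      rw [Nat.card_Ico]
      exact_mod_cast Nat.sub_le L 1
    exact mul_le_mul_of_nonneg_right this (by positivity)

end IsRootedBernoulliPercolation

/-! ### Choice of the parameters -/

theorem sq_le_two_pow {q : ℕ} (hq : 100 ≤ q) : (500 * q ^ 2 + 1) ^ 2 ≤ 2 ^ q := by
  induction q, hq using Nat.le_induction with
  | base => norm_num
  | succ q hq ih =>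
    -- Passing to `q + 1` multiplies the square by at most `49 / 25 < 2`.
    have h1 : 5 * (500 * (q + 1) ^ 2 + 1) ≤ 7 * (500 * q ^ 2 + 1) := by nlinarith
    have h2 := Nat.pow_le_pow_left h1 2
    rw [mul_pow, mul_pow] at h2
    rw [pow_succ 2 q]
    omega

/-- The bound below which all points of the construction lie. -/
def farBound (q : ℕ) : ℕ := 2 ^ (410 * q ^ 2)

/-- The number of independent trials. -/
def trialCount (q : ℕ) : ℕ := 2 ^ (14 * q) * (1000 * q ^ 2)

/-- The length of a window of `A` that is certain to contain a given pattern. -/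
def waitLen (q : ℕ) : ℕ := trialCount q * ((14 * q + 101 * q * (14 * q)) ^ 2 + 1)

/-- Besides the factor `2 ^ (14 q)` everything is polynomial in `q` and below `2 ^ (2 q)`. -/
theorem two_mul_waitLen_le {q : ℕ} (hq : 100 ≤ q) : 2 * waitLen q + 2 ≤ 2 ^ (18 * q) := by
  have h1 := sq_le_two_pow hq
  set Y := 500 * q ^ 2 + 1 with hY
  have hY1 : 100 ≤ Y := by nlinarith
  have h2 : 14 * q + 101 * q * (14 * q) ≤ 3 * Y := by nlinarith
  have h3 : (14 * q + 101 * q * (14 * q)) ^ 2 + 1 ≤ 10 * Y ^ 2 := by nlinarith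
  have h4 : 1000 * q ^ 2 ≤ 2 * Y := by omega
  have h5 : 1000 * q ^ 2 * ((14 * q + 101 * q * (14 * q)) ^ 2 + 1) ≤ 2 * Y * (10 * Y ^ 2) :=
    Nat.mul_le_mul h4 h3
  have h6 : 40 * Y ^ 3 + 2 ≤ Y ^ 4 := by
    have : Y ^ 4 = Y * Y ^ 3 := by ring
    have h7 : 100 * Y ^ 3 ≤ Y * Y ^ 3 := Nat.mul_le_mul_right _ hY1
    have h8 : 1 ≤ Y ^ 3 := Nat.one_le_pow _ _ (by omega)
    omega
  have h7 : Y ^ 4 ≤ 2 ^ (2 * q) := by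
    calc Y ^ 4 = (Y ^ 2) ^ 2 := by ring
      _ ≤ (2 ^ q) ^ 2 := Nat.pow_le_pow_left h1 2
      _ = 2 ^ (2 * q) := by rw [← pow_mul, mul_comm]
  have h8 : 1 ≤ 2 ^ (14 * q) := Nat.one_le_two_pow
  calc 2 * waitLen q + 2 = 2 ^ (14 * q) *
        (2 * (1000 * q ^ 2 * ((14 * q + 101 * q * (14 * q)) ^ 2 + 1))) + 2 := by
        unfold waitLen trialCount; ring
    _ ≤ 2 ^ (14 * q) * (2 * (2 * Y * (10 * Y ^ 2))) + 2 ^ (14 * q) * 2 := by gcongr; omega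
    _ = 2 ^ (14 * q) * (40 * Y ^ 3 + 2) := by ring
    _ ≤ 2 ^ (14 * q) * 2 ^ (2 * q) := Nat.mul_le_mul_left _ (h6.trans h7)
    _ = 2 ^ (16 * q) := by rw [← pow_add]; congr 1; ring
    _ ≤ 2 ^ (18 * q) := Nat.pow_le_pow_right (by norm_num) (by omega)

theorem le_two_pow_of_le_sq {q k : ℕ} (hq : 100 ≤ q) (hk : k ≤ (500 * q ^ 2 + 1) ^ 2) :
    k ≤ 2 ^ q := hk.trans (sq_le_two_pow hq)

theorem card_entries_le {q : ℕ} (hq : 100 ≤ q) : (entries q).card ≤ 2 ^ (24 * q) := by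
  rw [entries, Finset.card_product, Finset.card_range, Finset.card_range]
  have : 800 * q ^ 2 + 1 ≤ 2 ^ q := le_two_pow_of_le_sq hq (by nlinarith)
  calc (800 * q ^ 2 + 1) * 2 ^ (18 * q) ≤ 2 ^ q * 2 ^ (18 * q) := Nat.mul_le_mul_right _ this
    _ = 2 ^ (19 * q) := by rw [← pow_add]; congr 1; ring
    _ ≤ 2 ^ (24 * q) := Nat.pow_le_pow_right (by norm_num) (by omega)

theorem two_pow_mul_half_pow_le {a b c : ℕ} (h : a + c ≤ b) :
    (2 : ℝ) ^ a * (1 / 2) ^ b ≤ (1 / 2) ^ c := by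
  obtain ⟨d, rfl⟩ := Nat.exists_eq_add_of_le h
  have h1 : (2 : ℝ) ^ a * (1 / 2) ^ (a + c + d) = (2 * (1 / 2)) ^ a * (1 / 2) ^ d * (1 / 2) ^ c := by
    rw [mul_pow]; ring
  rw [h1]
  have h2 : ((1 : ℝ) / 2) ^ d ≤ 1 := pow_le_one₀ (by norm_num) (by norm_num)
  have h3 : (0 : ℝ) ≤ (1 / 2) ^ c := by positivity
  norm_num at h2 h3 ⊢
  nlinarith

/-- With `ε = 2 ^ (-14 q)` this is `(1 - ε) ^ (1 / ε) ≤ 1 / e ≤ 1 / 2`, raised to the power `1000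
q²`. -/
theorem one_sub_pow_trialCount_le (q : ℕ) :
    (1 - (1 / 2 : ℝ) ^ (14 * q)) ^ trialCount q ≤ (1 / 2) ^ (1000 * q ^ 2) := by
  have h1 : (0 : ℝ) ≤ 1 - (1 / 2) ^ (14 * q) := by
    have : ((1 : ℝ) / 2) ^ (14 * q) ≤ 1 := pow_le_one₀ (by norm_num) (by norm_num)
    linarith
  rw [trialCount, pow_mul]
  refine pow_le_pow_left₀ (pow_nonneg h1 _) ?_ _
  have h2 : 1 - (1 / 2 : ℝ) ^ (14 * q) ≤ Real.exp (-(1 / 2) ^ (14 * q)) :=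
    Real.one_sub_le_exp_neg _
  refine (pow_le_pow_left₀ h1 h2 _).trans ?_
  rw [← Real.exp_nat_mul]
  have h3 : (((2 : ℕ) ^ (14 * q) : ℕ) : ℝ) * (-(1 / 2) ^ (14 * q)) = -1 := by
    push_cast
    rw [mul_neg, ← mul_pow]
    norm_num
  rw [h3]
  have := Real.exp_one_gt_d9
  rw [Real.exp_neg, one_div]
  exact inv_anti₀ (by norm_num) (by linarith)

namespace IsRootedBernoulliPercolation

variable {Ω : Type*} [MeasurableSpace Ω] {μ : Measure Ω} [IsProbabilityMeasure μ] {A : Ω → Set ℕ}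

/-- In units of `q²` the leading exponents are `410 + 50 - 500` for density and `410 + 336 - 1000`
for the patterns; both are negative. -/
theorem prob_not_goodSource (hA : IsRootedBernoulliPercolation A μ) {q : ℕ} (hq : 100 ≤ q) :
    μ.real {ω | ¬ GoodSource q (farBound q) (waitLen q) (A ω)} ≤ 2 * (1 / 2) ^ (162 * q) := by
  have hq0 : 0 < q := by omega
  have hqq : 100 * q ≤ q ^ 2 := by nlinarith
  have h1 := hA.prob_not_denseBelow q (farBound q)
  have h2 := hA.prob_no_hit hq0 (farBound q) (r := trialCount q) (W := waitLen q) le_rfl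
    (card_entries_le hq)
  have h3 : ((farBound q : ℕ) : ℝ) * ((500 * q ^ 2 + 1) ^ (100 * q) * (1 / 2) ^ (500 * q ^ 2)) ≤
      (1 / 2) ^ (162 * q) := by
    have h4 : ((500 * q ^ 2 + 1 : ℕ) : ℝ) ^ (100 * q) ≤ 2 ^ (50 * q ^ 2) := by
      have : (500 * q ^ 2 + 1) ^ (100 * q) ≤ 2 ^ (50 * q ^ 2) := by
        calc (500 * q ^ 2 + 1) ^ (100 * q) = ((500 * q ^ 2 + 1) ^ 2) ^ (50 * q) := by
              rw [← pow_mul]; congr 1; ring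
          _ ≤ (2 ^ q) ^ (50 * q) := Nat.pow_le_pow_left (sq_le_two_pow hq) _
          _ = 2 ^ (50 * q ^ 2) := by rw [← pow_mul]; congr 1; ring
      exact_mod_cast this
    push_cast at h4
    calc ((farBound q : ℕ) : ℝ) * ((500 * q ^ 2 + 1) ^ (100 * q) * (1 / 2) ^ (500 * q ^ 2))
        ≤ 2 ^ (410 * q ^ 2) * (2 ^ (50 * q ^ 2) * (1 / 2) ^ (500 * q ^ 2)) := by
          unfold farBound; push_cast; gcongr
      _ = 2 ^ (460 * q ^ 2) * (1 / 2) ^ (500 * q ^ 2) := by rw [← mul_assoc, ← pow_add]; ring_nf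
      _ ≤ (1 / 2) ^ (162 * q) := two_pow_mul_half_pow_le (by omega)
  have h5 : ((farBound q : ℕ) : ℝ) * ((14 * q + 1) * (2 ^ (24 * q * (14 * q)) *
      (1 - (1 / 2) ^ (14 * q)) ^ trialCount q)) ≤ (1 / 2) ^ (162 * q) := by
    have h4 : ((14 * q + 1 : ℕ) : ℝ) ≤ 2 ^ q := by
      exact_mod_cast le_two_pow_of_le_sq hq (by nlinarith)
    push_cast at h4
    have h6 := one_sub_pow_trialCount_le q
    have h7 : (0 : ℝ) ≤ 1 - (1 / 2) ^ (14 * q) := by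
      have : ((1 : ℝ) / 2) ^ (14 * q) ≤ 1 := pow_le_one₀ (by norm_num) (by norm_num)
      linarith
    calc _ ≤ (2 : ℝ) ^ (410 * q ^ 2) * (2 ^ q * (2 ^ (24 * q * (14 * q)) *
          (1 / 2) ^ (1000 * q ^ 2))) := by
          unfold farBound; push_cast; gcongr
      _ = 2 ^ (410 * q ^ 2 + q + 24 * q * (14 * q)) * (1 / 2) ^ (1000 * q ^ 2) := by
          rw [pow_add, pow_add]; ring
      _ ≤ (1 / 2) ^ (162 * q) := two_pow_mul_half_pow_le (by
          have : 24 * q * (14 * q) = 336 * q ^ 2 := by ring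
          omega)
  have hsub : {ω | ¬ GoodSource q (farBound q) (waitLen q) (A ω)} ⊆
      {ω | ¬ DenseBelow q (farBound q) (A ω)} ∪ {ω | ¬ ∀ x, 1 ≤ x → x < farBound q → ∀ l,
        Admissible q l → l.length ≤ 14 * q → cost q l ≤ 14 * q →
        ∃ t < waitLen q, Fits q (A ω) (x + t) l} := by
    intro ω hω
    by_contra hcon
    simp only [Set.mem_union, Set.mem_ofPred_eq, not_or, not_not] at hcon
    exact hω ⟨hcon.1, hcon.2⟩
  refine (measureReal_mono hsub).trans ((measureReal_union_le _ _).trans ?_)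
  linarith

/-- The gaps and the cost give exponents `410 - 800` and `410 - 560` in units of `q²`. The start
gives only `(18 - 180) q = -162 q` and so determines the final rate. -/
theorem prob_not_goodTarget (hA : IsRootedBernoulliPercolation A μ) {q : ℕ} (hq : 100 ≤ q) :
    μ.real {ω | ¬ GoodTarget q (farBound q) (A ω)} ≤ 3 * (1 / 2) ^ (162 * q) := by
  have hq0 : 0 < q := by omega
  have hqq : 100 * q ≤ q ^ 2 := by nlinarith
  have h1 := hA.prob_not_shortGaps q (2 ^ (18 * q))
  have h2 := hA.prob_exists_gap (farBound q) (800 * q ^ 2)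
  have h3 := hA.prob_cost_gt hq0 (farBound q) (card_entries_le hq)
  have h4 : (((2 : ℕ) ^ (18 * q) : ℕ) : ℝ) * (1 / 2) ^ (180 * q) ≤ (1 / 2) ^ (162 * q) := by
    push_cast
    exact two_pow_mul_half_pow_le (by omega)
  have h5 : ((farBound q : ℕ) : ℝ) * (1 / 2) ^ (800 * q ^ 2) ≤ (1 / 2) ^ (162 * q) := by
    unfold farBound; push_cast
    exact two_pow_mul_half_pow_le (by omega)
  have h6 : ((farBound q : ℕ) : ℝ) * ((14 * q + 1) * (1 / 2) ^ (560 * q ^ 2)) ≤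
      (1 / 2) ^ (162 * q) := by
    have h4 : ((14 * q + 1 : ℕ) : ℝ) ≤ 2 ^ q := by
      exact_mod_cast le_two_pow_of_le_sq hq (by nlinarith)
    push_cast at h4
    calc _ ≤ (2 : ℝ) ^ (410 * q ^ 2) * (2 ^ q * (1 / 2) ^ (560 * q ^ 2)) := by
          unfold farBound; push_cast; gcongr
      _ = 2 ^ (410 * q ^ 2 + q) * (1 / 2) ^ (560 * q ^ 2) := by rw [pow_add]; ring
      _ ≤ (1 / 2) ^ (162 * q) := two_pow_mul_half_pow_le (by omega)
  have hsub : {ω | ¬ GoodTarget q (farBound q) (A ω)} ⊆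
      {ω | ¬ ShortGaps q (A ω) 0 (2 ^ (18 * q))} ∪
        ({ω | ¬ ∀ b < farBound q, ∃ b' ∈ A ω, b < b' ∧ b' ≤ b + 800 * q ^ 2} ∪
        {ω | ¬ ∀ v < farBound q, ∀ l, Admissible q l → l.length ≤ 14 * q →
          (∀ z ∈ gapSet v l, z ∉ A ω) → cost q l ≤ 14 * q}) := by
    intro ω hω
    by_contra hcon
    simp only [Set.mem_union, Set.mem_ofPred_eq, not_or, not_not] at hcon
    exact hω ⟨hcon.1, hcon.2.1, hcon.2.2⟩
  refine (measureReal_mono hsub).trans ((measureReal_union_le _ _).trans ?_)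
  have := measureReal_union_le (μ := μ)
    {ω | ¬ ∀ b < farBound q, ∃ b' ∈ A ω, b < b' ∧ b' ≤ b + 800 * q ^ 2}
    {ω | ¬ ∀ v < farBound q, ∀ l, Admissible q l → l.length ≤ 14 * q →
          (∀ z ∈ gapSet v l, z ∉ A ω) → cost q l ≤ 14 * q}
  linarith

end IsRootedBernoulliPercolation

/-! ### From partial maps to rough isometries -/

theorem exists_prev {A : Set ℕ} {p p' : ℕ} (hp : p ∈ A) (hp' : p' ∈ A) (h : p < p') :
    ∃ p₀, AdjIn A p₀ p' ∧ p ≤ p₀ := by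
  obtain ⟨b, hb, h1, h2, h3⟩ := exists_greatest_mem (t := p' - 1) hp (by omega)
  refine ⟨b, ⟨hb, hp', by omega, fun z hz => ?_⟩, h1⟩
  rcases lt_or_ge z p' with h4 | h4
  · exact Or.inl (h3 z hz (by omega))
  · exact Or.inr h4

theorem SegMap.sub_le {A B : Set ℕ} {M x y u v : ℕ} {T : ℕ → ℕ} (h : SegMap A B M x y u v T)
    {p : ℕ} (hp : p ∈ A) (hxp : x ≤ p) : ∀ p' ∈ A, p ≤ p' → p' ≤ y →
      T p' + M * p ≤ T p + M * p' := by
  intro p'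
  induction p' using Nat.strong_induction_on with
  | _ p' ih =>
    intro hp' hpp hy
    rcases hpp.eq_or_lt with rfl | hlt
    · omega
    · obtain ⟨p₀, hadj, h1⟩ := exists_prev hp hp' hlt
      have h2 := ih p₀ hadj.2.2.1 hadj.1 h1 (by have := hadj.2.2.1; omega)
      have h3 := h.adj_upper p₀ p' hadj (by omega) hy
      omega

/-- Every increase of the image by `k ≥ 1` costs a step of at most `M k` and a fibre of diameter at
most `M ≤ M k`, whence the factor `2`; the first fibre gives the final `M`. -/
theorem SegMap.le_sub {A B : Set ℕ} {M x y u v : ℕ} {T : ℕ → ℕ} (h : SegMap A B M x y u v T)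
    {p : ℕ} (hp : p ∈ A) (hxp : x ≤ p) : ∀ p' ∈ A, p ≤ p' → p' ≤ y →
      p' + 2 * (M * T p) ≤ p + 2 * (M * T p') + M := by
  intro p'
  induction p' using Nat.strong_induction_on with
  | _ p' ih =>
    intro hp' hpp hy
    by_cases heq : T p = T p'
    · have := h.fibre p hp p' hp' hxp hpp hy heq
      rw [heq]
      omega
    · classical
      have hex : ∃ z, z ∈ A ∧ p ≤ z ∧ z ≤ p' ∧ T z = T p' := ⟨p', hp', hpp, le_rfl, rfl⟩
      obtain ⟨hzA, hpz, hzp', hTz⟩ := Nat.find_spec hex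
      have hmin := fun m => @Nat.find_min _ _ hex m
      set z := Nat.find hex
      have hlt : p < z := by
        rcases hpz.eq_or_lt with h1 | h1
        · rw [← h1] at hTz; exact absurd hTz heq
        · exact h1
      obtain ⟨p₀, hadj, h1⟩ := exists_prev hp hzA hlt
      have h0 := hadj.2.2.1
      have hne : T p₀ ≠ T p' := fun hcon => hmin p₀ h0 ⟨hadj.1, h1, by omega, hcon⟩
      have h2 := ih p₀ (by omega) hadj.1 h1 (by omega)
      have h3 := h.adj_lower p₀ z hadj (by omega) (by omega) (by rw [hTz]; exact hne)
      have h4 := h.fibre z hzA p' hp' (by omega) hzp' hy hTz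
      have h5 := h.mono p₀ hadj.1 p' hp' (by omega) (by omega) hy
      have h6 : M * T p₀ + M ≤ M * T p' := by
        rw [← Nat.mul_succ]
        exact Nat.mul_le_mul_left _ (by omega)
      rw [hTz] at h3
      omega

/-- There is a map `S → U` as required by the theorem. -/
def HasMap (s : ℝ) (S U : Set ℕ) : Prop :=
  ∃ (hS : 0 ∈ S) (hU : 0 ∈ U) (T : S → U),
    IsRootedRoughIsometry ⟨0, hS⟩ ⟨0, hU⟩ T (30 * s) (1 / 2) (10 * s) ∧ Monotone T ∧
      IsMarkovRoughIsometry hS hU T (10 * s) (10 * s) (10 * s)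

/-- Here `M = 200 q ≤ 10 s`. With `δ` the distance of two images, `SegMap.le_sub` bounds the
distance of the points by `2 M δ + M ≤ 30 s (δ + 1 / 2)`, whence the constants `30 s` and `1 / 2`.
-/
theorem SegMap.hasMap {A B : Set ℕ} {q x u : ℕ} {T : ℕ → ℕ} (hq : 0 < q)
    (h : SegMap A B (200 * q) 0 x 0 u T) {y : ℕ} (hy : y ∈ A) (hyx : y ≤ x) {s : ℝ}
    (hs : 20 * (q : ℝ) ≤ s) : HasMap s (A ∩ Set.Iic y) (B ∩ Set.Iic (T y)) := by
  have hq' : (1 : ℝ) ≤ q := by exact_mod_cast hq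
  have hspos : 0 < s := by linarith
  have h0B : 0 ∈ B := by
    have := h.maps 0 h.left_mem le_rfl h.left_le
    rwa [h.map_left] at this
  let f : ↥(A ∩ Set.Iic y) → ↥(B ∩ Set.Iic (T y)) := fun p =>
    ⟨T p, h.maps p p.2.1 (Nat.zero_le _) (p.2.2.trans hyx),
      h.mono p p.2.1 y hy (Nat.zero_le _) p.2.2 hyx⟩
  have hfmono : Monotone f := fun a b hab =>
    h.mono a a.2.1 b b.2.1 (Nat.zero_le _) hab (b.2.2.trans hyx)
  have hdist : ∀ {S : Set ℕ} (a b : S), (a : ℕ) ≤ b → dist a b = (b : ℝ) - a := by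
    intro S a b hab
    rw [Subtype.dist_eq, Nat.dist_eq, abs_sub_comm, abs_of_nonneg]
    have : ((a : ℕ) : ℝ) ≤ (b : ℕ) := by exact_mod_cast hab
    linarith
  have hdense : ∀ b : ↥(B ∩ Set.Iic (T y)), ∃ a : ↥(A ∩ Set.Iic y), dist (f a) b ≤ 10 * s := by
    rintro ⟨b, hb, hbT⟩
    have hbT' : b ≤ T y := hbT
    have hTu : T y ≤ u := by
      have := h.mono y hy x h.right_mem (Nat.zero_le _) hyx le_rfl
      rwa [h.map_right] at this
    have hp : ∃ p ∈ A, p ≤ y ∧ b ≤ T p + 200 * q ∧ T p ≤ b + 200 * q := by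
      obtain ⟨p, hp, _, h2, h3, h4⟩ := h.dense b hb (Nat.zero_le _) (hbT'.trans hTu)
      rcases le_total p y with hpy | hpy
      · exact ⟨p, hp, hpy, h3, h4⟩
      -- If the approximating point lies beyond `y`, then `b ≤ T y ≤ T p`, and `y` serves instead.
      · have := h.mono y hy p hp (Nat.zero_le _) hpy h2
        exact ⟨y, hy, le_rfl, by omega, by omega⟩
    obtain ⟨p, hp, hpy, h3, h4⟩ := hp
    refine ⟨⟨p, hp, hpy⟩, ?_⟩
    rw [Subtype.dist_eq, Nat.dist_eq, abs_le]
    have h5 : (b : ℝ) ≤ T p + 200 * q := by exact_mod_cast h3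
    have h6 : (T p : ℝ) ≤ b + 200 * q := by exact_mod_cast h4
    simp only [f]
    constructor <;> linarith
  have hrough : ∀ a b : ↥(A ∩ Set.Iic y), (a : ℕ) ≤ b →
      1 / (30 * s) * dist a b - 1 / 2 ≤ dist (f a) (f b) ∧
        dist (f a) (f b) ≤ 30 * s * dist a b + 1 / 2 := by
    intro a b hab
    have hb := b.2.2.trans hyx
    have h1 := h.sub_le a.2.1 (Nat.zero_le _) b b.2.1 hab hb
    have h2 := h.le_sub a.2.1 (Nat.zero_le _) b b.2.1 hab hb
    have h3 := h.mono a a.2.1 b b.2.1 (Nat.zero_le _) hab hb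
    rw [hdist a b hab, hdist (f a) (f b) h3]
    simp only [f]
    have e1 : (T b : ℝ) + 200 * q * (a : ℕ) ≤ T a + 200 * q * (b : ℕ) := by exact_mod_cast h1
    have e2 : ((b : ℕ) : ℝ) + 2 * (200 * q * T a) ≤ (a : ℕ) + 2 * (200 * q * T b) + 200 * q := by
      exact_mod_cast h2
    have e3 : (T a : ℝ) ≤ T b := by exact_mod_cast h3
    have e4 : ((a : ℕ) : ℝ) ≤ (b : ℕ) := by exact_mod_cast hab
    constructor
    · rw [sub_le_iff_le_add, one_div_mul_eq_div, div_le_iff₀ (by positivity)]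
      nlinarith
    · nlinarith
  have h0A : 0 ∈ A ∩ Set.Iic y := ⟨h.left_mem, Nat.zero_le _⟩
  refine ⟨h0A, ⟨h0B, Nat.zero_le _⟩, f,
    { M_pos := by positivity
      D_nonneg := by norm_num
      R_nonneg := by positivity
      lower := ?_
      upper := ?_
      dense := fun b => (hdense b).imp fun a ha => by rwa [dist_comm]
      map_root := Subtype.ext h.map_left }, hfmono,
    { M_pos := by positivity
      F_nonneg := by positivity
      R_nonneg := by positivity
      map_zero := Subtype.ext h.map_left
      monotone := fun a b hab => hfmono hab
      adjacent := ?_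
      fibre := ?_
      dense := hdense }⟩
  · intro a b
    rcases le_total (a : ℕ) b with hab | hab
    · exact (hrough a b hab).1
    · rw [dist_comm a b, dist_comm (f a)]; exact (hrough b a hab).1
  · intro a b
    rcases le_total (a : ℕ) b with hab | hab
    · exact (hrough a b hab).2
    · rw [dist_comm a b, dist_comm (f a)]; exact (hrough b a hab).2
  · intro a b hab hne
    have hlt : (a : ℕ) < b := hab.1
    have hadj : AdjIn A a b := by
      refine ⟨a.2.1, b.2.1, hlt, fun z hz => ?_⟩
      by_contra hcon
      push Not at hcon
      have hzy : z ≤ y := hcon.2.le.trans b.2.2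
      exact hab.2 (c := ⟨z, hz, hzy⟩) hcon.1 hcon.2
    have hb := b.2.2.trans hyx
    have hne' : T a ≠ T b := fun hcon => hne (Subtype.ext hcon)
    have h1 := h.adj_upper a b hadj (Nat.zero_le _) hb
    have h2 := h.adj_lower a b hadj (Nat.zero_le _) hb hne'
    have h3 := h.mono a a.2.1 b b.2.1 (Nat.zero_le _) hlt.le hb
    rw [hdist a b hlt.le, hdist (f a) (f b) h3]
    simp only [f]
    have e1 : (T b : ℝ) + 200 * q * (a : ℕ) ≤ T a + 200 * q * (b : ℕ) := by exact_mod_cast h1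
    have e2 : ((b : ℕ) : ℝ) + 200 * q * T a ≤ (a : ℕ) + 200 * q * T b := by exact_mod_cast h2
    have e3 : (T a : ℝ) ≤ T b := by exact_mod_cast h3
    have e4 : ((a : ℕ) : ℝ) ≤ (b : ℕ) := by exact_mod_cast hlt.le
    constructor
    · rw [one_div_mul_eq_div, div_le_iff₀ (by positivity)]
      nlinarith
    · nlinarith
  · have key : ∀ a b : ↥(A ∩ Set.Iic y), (a : ℕ) ≤ b → f a = f b → dist a b ≤ 10 * s := by
      intro a b hab heq
      have h1 := h.fibre a a.2.1 b b.2.1 (Nat.zero_le _) hab (b.2.2.trans hyx)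
        (congrArg Subtype.val heq)
      rw [hdist a b hab]
      have e1 : ((b : ℕ) : ℝ) ≤ (a : ℕ) + 200 * q := by exact_mod_cast h1
      linarith
    intro a b heq
    rcases le_total (a : ℕ) b with hab | hab
    · exact key a b hab heq
    · rw [dist_comm]; exact key b a hab heq.symm

/-! ### Initial segments and the measurability of the target size -/

theorem firstPoints_ncard_Iic (B : Set ℕ) (t : ℕ) :
    firstPoints B (B ∩ Set.Iic t).ncard = B ∩ Set.Iic t := by
  ext b
  simp only [firstPoints, Set.mem_ofPred_eq, Set.mem_inter_iff, Set.mem_Iic]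
  refine and_congr_right fun hb => ⟨fun h => ?_, fun h => ?_⟩
  · by_contra hcon
    refine absurd h (not_lt.2 (Set.ncard_le_ncard ?_ ((Set.finite_Iio b).inter_of_right _)))
    exact fun z hz => ⟨hz.1, lt_of_le_of_lt hz.2 (not_le.1 hcon)⟩
  · refine Set.ncard_lt_ncard ⟨fun z hz => ⟨hz.1, hz.2.le.trans h⟩, fun hcon => ?_⟩
      ((Set.finite_Iic t).inter_of_right _)
    exact lt_irrefl b (hcon ⟨hb, h⟩).2

theorem exists_firstPoints_eq {A : Set ℕ} {n x : ℕ} (h0 : 0 ∈ A) (hn : 0 < n)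
    (hx : n ≤ countIn A (Finset.Ioc 0 x)) :
    ∃ y ∈ A, y ≤ x ∧ firstPoints A n = A ∩ Set.Iic y := by
  classical
  have hsub : ∀ z ∈ firstPoints A n, z ≤ x := by
    intro z hz
    by_contra hcon
    refine absurd hz.2 (not_lt.2 (hx.trans ?_))
    rw [countIn, ← Set.ncard_coe_finset]
    refine Set.ncard_le_ncard (fun a ha => ?_) ((Set.finite_Iio z).inter_of_right _)
    simp only [Finset.coe_filter, Finset.mem_Ioc, Set.mem_ofPred_eq] at ha
    exact ⟨ha.2, by simp only [Set.mem_Iio]; omega⟩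
  have hzero : 0 ∈ firstPoints A n := ⟨h0, by simpa using hn⟩
  obtain ⟨y, hy, _, hyx, hmax⟩ := exists_greatest_mem hzero (Nat.zero_le x)
  refine ⟨y, hy.1, hyx, ?_⟩
  ext z
  refine ⟨fun hz => ⟨hz.1, hmax z hz (hsub z hz)⟩, fun hz => ⟨hz.1, lt_of_le_of_lt ?_ hy.2⟩⟩
  exact Set.ncard_le_ncard (fun a ha => ⟨ha.1, show a < y from
    lt_of_lt_of_le (show a < z from ha.2) hz.2⟩)
    ((Set.finite_Iio y).inter_of_right _)

theorem firstPoints_inter_Iio {A : Set ℕ} {n y L : ℕ} (h : firstPoints A n = A ∩ Set.Iic y)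
    (hyL : y < L) : firstPoints (A ∩ Set.Iio L) n = firstPoints A n := by
  ext z
  have key : z < L → A ∩ Set.Iio L ∩ Set.Iio z = A ∩ Set.Iio z := by
    intro hz
    rw [Set.inter_assoc, Set.Iio_inter_Iio, inf_eq_right.2 hz.le]
  constructor
  · rintro ⟨⟨hzA, hzL⟩, hz⟩
    rw [key hzL] at hz
    exact ⟨hzA, hz⟩
  · intro hz
    have hzL : z < L := by
      rw [h] at hz
      exact lt_of_le_of_lt hz.2 hyL
    refine ⟨⟨hz.1, hzL⟩, ?_⟩
    rw [key hzL]
    exact hz.2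

theorem inter_Iio_inter_Iic (B : Set ℕ) {t L : ℕ} (h : t < L) :
    B ∩ Set.Iio L ∩ Set.Iic t = B ∩ Set.Iic t := by
  rw [Set.inter_assoc, Set.inter_eq_self_of_subset_right
    (show Set.Iic t ⊆ Set.Iio L from fun z hz => lt_of_le_of_lt hz h)]

/-- The function factors through a finite discrete space, so an arbitrary choice of `g` is harmless.
-/
theorem measurable_of_restrict (L : ℕ) (g : Set ℕ → Set ℕ → ℕ) :
    Measurable fun p : Set ℕ × Set ℕ => g (p.1 ∩ Set.Iio L) (p.2 ∩ Set.Iio L) := by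
  let r : Set ℕ → (Fin L → Prop) := fun b i => (i : ℕ) ∈ b
  have hr : Measurable r := measurable_pi_iff.2 fun i => measurable_set_mem (i : ℕ)
  let G : (Fin L → Prop) × (Fin L → Prop) → ℕ := fun p =>
    g {k | ∃ h : k < L, p.1 ⟨k, h⟩} {k | ∃ h : k < L, p.2 ⟨k, h⟩}
  have hG : Measurable G := Measurable.of_discrete
  have hset : ∀ b : Set ℕ, {k | ∃ h : k < L, r b ⟨k, h⟩} = b ∩ Set.Iio L := by
    intro b
    ext k
    simp only [r, Set.mem_ofPred_eq, Set.mem_inter_iff, Set.mem_Iio]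
    tauto
  have heq : (fun p : Set ℕ × Set ℕ => g (p.1 ∩ Set.Iio L) (p.2 ∩ Set.Iio L)) =
      G ∘ fun p => (r p.1, r p.2) := by
    funext p
    simp only [G, Function.comp, hset]
  rw [heq]
  exact hG.comp ((hr.comp measurable_fst).prodMk (hr.comp measurable_snd))

open Classical in
/-- The number of points of the initial segment of `b` on which the first `n` points of `a` can be
mapped. -/
noncomputable def targetSize (s : ℝ) (n L : ℕ) (a b : Set ℕ) : ℕ :=
  if h : ∃ t < L, HasMap s (firstPoints a n) (b ∩ Set.Iic t) then
    (b ∩ Set.Iic h.choose).ncard else 0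

/-- The choice in `targetSize` sees only the truncations at `L`. Both segments involved end below
`L`, so truncation does not affect them. -/
theorem hasMap_targetSize {s : ℝ} {n L y t : ℕ} {A B : Set ℕ}
    (hA : firstPoints A n = A ∩ Set.Iic y) (hy : y < L) (ht : t < L)
    (h : HasMap s (firstPoints A n) (B ∩ Set.Iic t)) :
    HasMap s (firstPoints A n)
      (firstPoints B (targetSize s n L (A ∩ Set.Iio L) (B ∩ Set.Iio L))) := by
  have hex : ∃ t < L, HasMap s (firstPoints (A ∩ Set.Iio L) n) (B ∩ Set.Iio L ∩ Set.Iic t) := by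
    refine ⟨t, ht, ?_⟩
    rwa [firstPoints_inter_Iio hA hy, inter_Iio_inter_Iic B ht]
  have hspec := hex.choose_spec
  rw [targetSize, dif_pos hex]
  generalize hex.choose = t' at hspec ⊢
  rw [firstPoints_inter_Iio hA hy, inter_Iio_inter_Iic B hspec.1] at hspec
  rw [inter_Iio_inter_Iic B hspec.1, firstPoints_ncard_Iic]
  exact hspec.2

/-! ### Conclusion -/

theorem farBound_ge {q n : ℕ} (hq : 100 ≤ q) (hn : n ≤ 2 ^ (20 * q + 20) ^ 2) :
    3 * (100000 * q ^ 3 * n + 14 * q * (2 ^ (18 * q) + 800 * q ^ 2)) + 3 ≤ farBound q := by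
  have h1 : 100000 * q ^ 3 ≤ 2 ^ q := le_two_pow_of_le_sq hq (by nlinarith [sq_nonneg (q - 1)])
  have h2 : 14 * q ≤ 2 ^ q := le_two_pow_of_le_sq hq (by nlinarith)
  have h3 : 800 * q ^ 2 ≤ 2 ^ (18 * q) :=
    (le_two_pow_of_le_sq hq (by nlinarith)).trans (Nat.pow_le_pow_right (by norm_num) (by omega))
  -- The exponent `(20 q + 20)²` with `q² + q` to spare for the other factors; for `q ≥ 100` even `e
  -- + 4` stays below `410 q²`.
  set e := 401 * q ^ 2 + 801 * q + 400 with he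
  have h4 : 100000 * q ^ 3 * n ≤ 2 ^ e := by
    calc 100000 * q ^ 3 * n ≤ 2 ^ q * 2 ^ (20 * q + 20) ^ 2 := Nat.mul_le_mul h1 hn
      _ = 2 ^ (q + (20 * q + 20) ^ 2) := by rw [pow_add]
      _ ≤ 2 ^ e := Nat.pow_le_pow_right (by norm_num) (by rw [he]; nlinarith)
  have h5 : 14 * q * (2 ^ (18 * q) + 800 * q ^ 2) ≤ 2 ^ e := by
    calc 14 * q * (2 ^ (18 * q) + 800 * q ^ 2) ≤ 2 ^ q * (2 * 2 ^ (18 * q)) :=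
          Nat.mul_le_mul h2 (by omega)
      _ = 2 ^ (q + (1 + 18 * q)) := by rw [pow_add, pow_add, pow_one]
      _ ≤ 2 ^ e := Nat.pow_le_pow_right (by norm_num) (by rw [he]; nlinarith)
  have h6 : 2 ^ (e + 4) ≤ farBound q :=
    Nat.pow_le_pow_right (by norm_num) (by rw [he]; nlinarith)
  have h7 : 1 ≤ 2 ^ e := Nat.one_le_two_pow
  rw [pow_add] at h6
  omega

/-- The deterministic part: good sets admit the required map. -/
theorem hasMap_of_good {q n L W : ℕ} {A B : Set ℕ} {s : ℝ} (hq0 : 0 < q) (hn0 : 0 < n)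
    (hfar : 3 * (100000 * q ^ 3 * n + 14 * q * (2 ^ (18 * q) + 800 * q ^ 2)) + 3 ≤ L)
    (hW : 2 * W + 2 ≤ 2 ^ (18 * q)) (hV : 1000 * q ^ 2 ≤ 2 ^ (18 * q))
    (hs : 20 * (q : ℝ) ≤ s) (h0A : 0 ∈ A) (h0B : 0 ∈ B)
    (hA : GoodSource q L W A) (hB : GoodTarget q L B) :
    HasMap s (firstPoints A n) (firstPoints B
      (targetSize s n L (A ∩ Set.Iio L) (B ∩ Set.Iio L))) := by
  -- As the map stretches by at most `200 q`, reaching `R = 100000 q³ n` in `B` forces `x ≥ 500 q²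
  -- n`, and so many windows hold at least `n` points of `A`.
  obtain ⟨x, u, T, hT, hu1, hu2, hxu⟩ := exists_segMap_far (R := 100000 * q ^ 3 * n) hq0 hA hB h0A
    h0B hW hV (by omega)
  have h1 := hT.sub_le h0A le_rfl x hT.right_mem (Nat.zero_le _) le_rfl
  rw [hT.map_left, hT.map_right] at h1
  have h2 : 500 * q ^ 2 * n ≤ x := by
    refine Nat.le_of_mul_le_mul_left (?_ : 200 * q * (500 * q ^ 2 * n) ≤ 200 * q * x) (by omega)
    have : 200 * q * (500 * q ^ 2 * n) = 100000 * q ^ 3 * n := by ring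
    omega
  have h3 : n ≤ countIn A (Finset.Ioc 0 x) := by
    have h4 := hA.dense.countIn_ge (x := 0) n (by omega) hq0
    have h5 : n ≤ 100 * q * n := Nat.le_mul_of_pos_left _ (by omega)
    refine (h5.trans h4).trans (countIn_mono (Finset.Ioc_subset_Ioc_right (by omega)))
  obtain ⟨y, hy, hyx, hfp⟩ := exists_firstPoints_eq h0A hn0 h3
  have hTy := hT.mono y hy x hT.right_mem (Nat.zero_le _) hyx le_rfl
  rw [hT.map_right] at hTy
  refine hasMap_targetSize hfp (by omega) (t := T y) (by omega) ?_
  rw [hfp]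
  exact hT.hasMap hq0 hy hyx hs

theorem exists_scale {k n : ℕ} (hk : (2000 : ℝ) ^ 2 ≤ k) (hn : 2 ^ k < n) :
    ∃ q : ℕ, 100 ≤ q ∧ 20 * (q : ℝ) ≤ Real.sqrt (Real.logb 2 n) ∧
      Real.sqrt (Real.logb 2 n) < 20 * (q : ℝ) + 20 ∧ n ≤ 2 ^ (20 * q + 20) ^ 2 := by
  set s := Real.sqrt (Real.logb 2 n) with hs
  have hn0 : 0 < n := lt_of_le_of_lt (Nat.zero_le _) hn
  have hnR : (0 : ℝ) < n := by exact_mod_cast hn0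
  have hlog : (2000 : ℝ) ^ 2 ≤ Real.logb 2 n := by
    refine hk.trans ?_
    rw [Real.le_logb_iff_rpow_le (by norm_num) hnR, Real.rpow_natCast]
    exact_mod_cast hn.le
  have hs2000 : 2000 ≤ s := Real.le_sqrt_of_sq_le hlog
  have hs0 : 0 ≤ s := by linarith
  have hq2 : s < 20 * (⌊s / 20⌋₊ : ℝ) + 20 := by
    have := Nat.lt_floor_add_one (s / 20)
    linarith
  refine ⟨⌊s / 20⌋₊, Nat.le_floor (by push_cast; linarith), ?_, hq2, ?_⟩
  · have := Nat.floor_le (show 0 ≤ s / 20 by positivity)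
    linarith
  · have h1 : Real.logb 2 n ≤ ((20 * ⌊s / 20⌋₊ + 20) ^ 2 : ℕ) := by
      rw [← Real.sq_sqrt (show 0 ≤ Real.logb 2 n from (sq_nonneg _).trans hlog)]
      push_cast
      exact pow_le_pow_left₀ hs0 hq2.le 2
    rw [Real.logb_le_iff_le_rpow (by norm_num) hnR, Real.rpow_natCast] at h1
    exact_mod_cast h1

/-- With high probability the two percolations are simultaneously good. -/
theorem exists_good_event {Ω : Type*} [MeasurableSpace Ω] {μ : Measure Ω}
    [IsProbabilityMeasure μ] {A B : Ω → Set ℕ} (hA : IsRootedBernoulliPercolation A μ)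
    (hB : IsRootedBernoulliPercolation B μ) {q : ℕ} {s : ℝ} (hq : 100 ≤ q)
    (hs : s < 20 * (q : ℝ) + 20) :
    ∃ E : Set Ω, MeasurableSet E ∧ 1 - (2 : ℝ) ^ (-8 * s) ≤ μ.real E ∧
      ∀ ω ∈ E, GoodSource q (farBound q) (waitLen q) (A ω) ∧ GoodTarget q (farBound q) (B ω) := by
  set bad : Set Ω := {ω | ¬ GoodSource q (farBound q) (waitLen q) (A ω)} ∪
    {ω | ¬ GoodTarget q (farBound q) (B ω)} with hbad
  -- The measurable hull has the same measure as the bad event, whose measurability need not be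
  -- checked.
  refine ⟨(toMeasurable μ bad)ᶜ, (measurableSet_toMeasurable _ _).compl, ?_, ?_⟩
  · rw [probReal_compl_eq_one_sub (measurableSet_toMeasurable _ _), measureReal_def,
      measure_toMeasurable, ← measureReal_def]
    have h1 : μ.real bad ≤ 5 * (1 / 2) ^ (162 * q) := by
      refine (measureReal_union_le _ _).trans ?_
      have := hA.prob_not_goodSource hq
      have := hB.prob_not_goodTarget hq
      linarith
    have h2 : 5 * (1 / 2 : ℝ) ^ (162 * q) ≤ (1 / 2) ^ (160 * q + 160) := by
      calc 5 * (1 / 2 : ℝ) ^ (162 * q) ≤ 2 ^ 3 * (1 / 2 : ℝ) ^ (162 * q) := by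
            gcongr; norm_num
        _ ≤ _ := two_pow_mul_half_pow_le (by omega)
    have h3 : (1 / 2 : ℝ) ^ (160 * q + 160) ≤ 2 ^ (-8 * s) := by
      rw [one_div, inv_pow, ← Real.rpow_natCast, ← Real.rpow_neg (by norm_num)]
      refine Real.rpow_le_rpow_of_exponent_le (by norm_num) ?_
      push_cast
      linarith
    linarith
  · intro ω hω
    have hω' : ω ∉ bad := fun h => hω (subset_toMeasurable μ bad h)
    simpa only [hbad, Set.mem_union, Set.mem_ofPred_eq, not_or, not_not] using hω'

theorem thousand_mul_sq_le {q : ℕ} (hq : 100 ≤ q) : 1000 * q ^ 2 ≤ 2 ^ (18 * q) :=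
  (le_two_pow_of_le_sq hq (by nlinarith)).trans (Nat.pow_le_pow_right (by norm_num) (by omega))

theorem exists_targetSize_event {q n : ℕ} {s : ℝ} (hn0 : 0 < n) (hq : 100 ≤ q)
    (hq1 : 20 * (q : ℝ) ≤ s) (hq2 : s < 20 * (q : ℝ) + 20) (hn : n ≤ 2 ^ (20 * q + 20) ^ 2) :
    ∃ m : Set ℕ × Set ℕ → ℕ, Measurable m ∧
      ∀ (Ω : Type*) [MeasurableSpace Ω] (μ : Measure Ω) [IsProbabilityMeasure μ]
        (A B : Ω → Set ℕ),
        IsRootedBernoulliPercolation A μ → IsRootedBernoulliPercolation B μ →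
        ∃ E : Set Ω, MeasurableSet E ∧ 1 - (2 : ℝ) ^ (-8 * s) ≤ μ.real E ∧
          ∀ ω ∈ E, HasMap s (firstPoints (A ω) n) (firstPoints (B ω) (m (A ω, B ω))) := by
  refine ⟨fun p => targetSize s n (farBound q) (p.1 ∩ Set.Iio (farBound q))
    (p.2 ∩ Set.Iio (farBound q)), measurable_of_restrict (farBound q) (targetSize s n (farBound q)),
    ?_⟩
  intro Ω _ μ _ A B hA hB
  obtain ⟨E, hE, hp, hgood⟩ := exists_good_event hA hB hq hq2
  exact ⟨E, hE, hp, fun ω hω => hasMap_of_good (by omega) hn0 (farBound_ge hq hn)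
    (two_mul_waitLen_le hq) (thousand_mul_sq_le hq) hq1 (hA.zero_mem ω) (hB.zero_mem ω)
    (hgood ω hω).1 (hgood ω hω).2⟩

theorem theorem2p5 :
    ∃ N : ℕ, 0 < N ∧ ∀ n : ℕ, N < n →
      ∃ m : Set ℕ × Set ℕ → ℕ, Measurable m ∧
        ∀ (Ω : Type*) [MeasurableSpace Ω] (μ : Measure Ω) [IsProbabilityMeasure μ]
          (A B : Ω → Set ℕ),
          IsRootedBernoulliPercolation A μ → IsRootedBernoulliPercolation B μ →
          IndepFun A B μ →
          ∃ E : Set Ω, MeasurableSet E ∧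
            1 - (2 : ℝ) ^ (-8 * Real.sqrt (Real.logb 2 n)) ≤ μ.real E ∧
            ∀ ω ∈ E,
              ∃ (hA : 0 ∈ firstPoints (A ω) n) (hB : 0 ∈ firstPoints (B ω) (m (A ω, B ω)))
                (T : firstPoints (A ω) n → firstPoints (B ω) (m (A ω, B ω))),
                IsRootedRoughIsometry ⟨0, hA⟩ ⟨0, hB⟩ T
                  (30 * Real.sqrt (Real.logb 2 n)) (1 / 2) (10 * Real.sqrt (Real.logb 2 n)) ∧
                Monotone T ∧
                IsMarkovRoughIsometry hA hB T (10 * Real.sqrt (Real.logb 2 n))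
                  (10 * Real.sqrt (Real.logb 2 n)) (10 * Real.sqrt (Real.logb 2 n)) := by
  -- For `n > 2 ^ k` the square root is at least `2000 = 20 * 100`, so that `q ≥ 100`.
  obtain ⟨k, hk⟩ := exists_nat_ge ((2000 : ℝ) ^ 2)
  refine ⟨2 ^ k, Nat.two_pow_pos k, fun n hn => ?_⟩
  obtain ⟨q, hq, hq1, hq2, hn2⟩ := exists_scale hk hn
  obtain ⟨m, hm, h⟩ := exists_targetSize_event (lt_of_le_of_lt (Nat.zero_le _) hn) hq hq1 hq2 hn2
  refine ⟨m, hm, fun Ω _ μ _ A B hA hB _ => ?_⟩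
  exact h Ω μ A B hA hB
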